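/- **Lemma (Spectral Norm Row PCP).** Notation. For a real matrix $M$, $\|M\|_2$ is the spectral norm, $\|M\|_F$ the Frobenius norm, $M^+$ the Moore–Penrose pseudoinverse, and $M_k$ a minimizer of $\|M-B\|_F$ over all matrices $B$ of rank at most $k$. With $m_i$ the $i$-th column of $M$, the $i$-th rank-$k$ ridge leverage score of $M$ is $$\tau_i^k(M)=m_i^T\Bigl(MM^T+\tfrac{\|M-M_k\|_F^2}{k}I\Bigr)^{+}m_i .$$ *Setting.* Let $A\in\mathbb R^{n\times n}$ be positive semidefinite with square root $A^{1/2}$, let $k\ge 1$ be an integer, $0<\epsilon<1$, and $c,c'>0$. Put $k'=\lceil ck/\epsilon^2\rceil$, let $\tilde\tau_i\ge\tau_i^{k'}(A^{1/2})$ for $i=1,\dots,n$ be overestimates of the rank-$k'$ ridge leverage scores of $A^{1/2}$, and set $$\tilde\ell_i=4\epsilon\sqrt{\tfrac nk}\,\tilde\tau_i,\qquad p_i=\frac{\tilde\ell_i}{\sum_j\tilde\ell_j},\qquad t=\Bigl\lceil\frac{c'\log n}{\epsilon^2}\sum_i\tilde\ell_i\Bigr\rceil .$$ Let $S_1,S_2\in\mathbb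 R^{n\times t}$ be random matrices, each having independent columns, whose $j$-th column equals $\frac1{\sqrt{tp_i}}e_i$ with probability $p_i$ ($i=1,\dots,n$). The joint distribution of $S_1$ and $S_2$ is arbitrary; in particular they may be independent of each other. (1) For every $d>0$ there are constants $c_0,c_0'>0$, depending only on $d$, such that for all $c\ge c_0$, $c'\ge c_0'$ and all $n,k,\epsilon,A,\tilde\tau$ as above with $n\ge k/\epsilon^2$, the following holds with probability at least $1-1/n^d$: with $\tilde A=S_2^TAS_1$, simultaneously for all orthogonal projections $P\in\mathbb R^{t\times t}$ (of any rank), $$(1-\epsilon)\|AS_1(I-P)\|_2^2-\frac{\epsilon}{k}\|A-A_k\|_F^2\;\le\;\|\tilde A(I-P)\|_2^2\;\le\;(1+\epsilon)\|AS_1(I-P)\|_2^2+\frac{\epsilon}{k}\|A-A_k\|_F^2 .$$ (2) For all $c,c'>0$ and $K\ge1$ there is a constant $C>0$ such that, for all $n,k,\epsilon,A,\tilde\tau$ as above (with no condition relating $n$ to $k/\epsilon^2$), if $\tilde\tau_i\le K\,\tau_i^{k'}(A^{1/2})$ for all $i$, then $t\le C\,\frac{\sqrt{nk}\,\log n}{\epsilon^3}$.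 -/

import Mathlib

open MeasureTheory ProbabilityTheory

/-- The spectral norm `‖M‖₂` (the operator norm for the Euclidean norms) of a real matrix. -/
noncomputable def specNorm {m n : ℕ} (M : Matrix (Fin m) (Fin n) ℝ) : ℝ :=
  ‖LinearMap.toContinuousLinearMap (Matrix.toEuclideanLin M)‖

/-- The squared Frobenius norm `‖M‖_F²`. -/
def frobSq {m n : ℕ} (M : Matrix (Fin m) (Fin n) ℝ) : ℝ :=
  ∑ i, ∑ j, M i j ^ 2

/-- `‖M - M_k‖_F²`, where `M_k` minimizes `‖M - B‖_F` among the matrices `B` of rank at most `k`: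
the smallest squared Frobenius error of an approximation of rank at most `k`. -/
noncomputable def lowRankErrSq {m n : ℕ} (M : Matrix (Fin m) (Fin n) ℝ) (k : ℕ) : ℝ :=
  sInf {x : ℝ | ∃ B : Matrix (Fin m) (Fin n) ℝ, B.rank ≤ k ∧ x = frobSq (M - B)}

/-- The four Penrose equations: `X` is the Moore–Penrose pseudoinverse of `M`. -/
structure IsMoorePenrose {m n : ℕ} (M : Matrix (Fin m) (Fin n) ℝ)
    (X : Matrix (Fin n) (Fin m) ℝ) : Prop where
  mul_mul_self : M * X * M = M
  self_mul_mul : X * M * X = X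
  transpose_left : (M * X).transpose = M * X
  transpose_right : (X * M).transpose = X * M

theorem exists_symm_pinv {n : ℕ} {G : Matrix (Fin n) (Fin n) ℝ} (hG : G.IsHermitian) :
    ∃ H : Matrix (Fin n) (Fin n) ℝ,
      G * H * G = G ∧ H * G * H = H ∧ G * H = H * G ∧ H.transpose = H := by
  have hc : ∀ f : ℝ → ℝ, ContinuousOn f (spectrum ℝ G) := fun f =>
    (Matrix.finite_real_spectrum (A := G)).continuousOn f
  have hs : IsSelfAdjoint G := hG
  have hid : cfc (fun x : ℝ => x) G = G := cfc_id' ℝ G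
  have e1 : G * cfc (fun x : ℝ => x⁻¹) G = cfc (fun x : ℝ => x * x⁻¹) G := by
    rw [cfc_mul (fun x : ℝ => x) (fun x : ℝ => x⁻¹) G (hc _) (hc _), hid]
  have e2 : cfc (fun x : ℝ => x⁻¹) G * G = cfc (fun x : ℝ => x⁻¹ * x) G := by
    rw [cfc_mul (fun x : ℝ => x⁻¹) (fun x : ℝ => x) G (hc _) (hc _), hid]
  refine ⟨cfc (fun x : ℝ => x⁻¹) G, ?_, ?_, ?_, ?_⟩
  · have := cfc_mul (fun x : ℝ => x * x⁻¹) (fun x : ℝ => x) G (hc _) (hc _)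
    rw [hid, ← e1] at this
    rw [← this]
    simp [hid]
  · have := cfc_mul (fun x : ℝ => x⁻¹ * x) (fun x : ℝ => x⁻¹) G (hc _) (hc _)
    rw [← e2] at this
    rw [← this]
    congr 1
    funext x
    rcases eq_or_ne x 0 with rfl | hx
    · simp
    · field_simp
  · rw [e1, e2]
    congr 1
    funext x
    exact mul_comm _ _
  · have h : IsSelfAdjoint (cfc (fun x : ℝ => x⁻¹) G) := cfc_predicate _ _
    have h2 : (cfc (fun x : ℝ => x⁻¹) G).conjTranspose = cfc (fun x : ℝ => x⁻¹) G := h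
    rwa [Matrix.conjTranspose_eq_transpose_of_trivial] at h2

theorem exists_isMoorePenrose {m n : ℕ} (M : Matrix (Fin m) (Fin n) ℝ) :
    ∃ X, IsMoorePenrose M X := by
  have hG : (M.transpose * M).IsHermitian := by
    rw [← Matrix.conjTranspose_eq_transpose_of_trivial]
    exact Matrix.isHermitian_conjTranspose_mul_self M
  obtain ⟨H, h1, h2, h3, h4⟩ := exists_symm_pinv hG
  have hz : M * (H * (M.transpose * M) - 1) = 0 := by
    rw [← Matrix.conjTranspose_mul_self_eq_zero, Matrix.conjTranspose_eq_transpose_of_trivial,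
      Matrix.transpose_mul, Matrix.mul_assoc, ← Matrix.mul_assoc M.transpose,
      Matrix.mul_sub (M.transpose * M), ← Matrix.mul_assoc _ H, h1, Matrix.mul_one, sub_self,
      Matrix.mul_zero]
  refine ⟨H * M.transpose, ?_, ?_, ?_, ?_⟩
  · rw [Matrix.mul_sub, Matrix.mul_one, sub_eq_zero] at hz
    simpa [Matrix.mul_assoc] using hz
  · have := congrArg (fun Y => Y * M.transpose) h2
    simpa [Matrix.mul_assoc] using this
  · simp [Matrix.transpose_mul, h4, Matrix.mul_assoc]
  · rw [Matrix.mul_assoc, Matrix.transpose_mul, h4, Matrix.transpose_mul,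
      Matrix.transpose_transpose, h3]

theorem IsMoorePenrose.unique {m n : ℕ} {M : Matrix (Fin m) (Fin n) ℝ}
    {X Y : Matrix (Fin n) (Fin m) ℝ} (hX : IsMoorePenrose M X) (hY : IsMoorePenrose M Y) :
    X = Y := by
  have hl : M * X = M * Y := by
    calc M * X = (M * Y * M) * X := by rw [hY.mul_mul_self]
      _ = (M * Y).transpose * (M * X).transpose := by
          rw [hX.transpose_left, hY.transpose_left, Matrix.mul_assoc]
      _ = (M * X * M * Y).transpose := by rw [← Matrix.transpose_mul]; simp only [Matrix.mul_assoc]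
      _ = M * Y := by rw [hX.mul_mul_self, hY.transpose_left]
  have hr : X * M = Y * M := by
    calc X * M = X * (M * Y * M) := by rw [hY.mul_mul_self]
      _ = (X * M).transpose * (Y * M).transpose := by
          rw [hX.transpose_right, hY.transpose_right]; simp only [Matrix.mul_assoc]
      _ = (Y * (M * X * M)).transpose := by rw [← Matrix.transpose_mul]; simp only [Matrix.mul_assoc]
      _ = Y * M := by rw [hX.mul_mul_self, hY.transpose_right]
  calc X = X * M * X := hX.self_mul_mul.symm
    _ = Y * (M * X) := by rw [hr, Matrix.mul_assoc]
    _ = Y * M * Y := by rw [hl, Matrix.mul_assoc]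
    _ = Y := hY.self_mul_mul

/-- The Moore–Penrose pseudoinverse `M⁺`. -/
noncomputable def pinv {m n : ℕ} (M : Matrix (Fin m) (Fin n) ℝ) : Matrix (Fin n) (Fin m) ℝ :=
  (exists_isMoorePenrose M).choose

theorem pinv_spec {m n : ℕ} (M : Matrix (Fin m) (Fin n) ℝ) : IsMoorePenrose M (pinv M) :=
  (exists_isMoorePenrose M).choose_spec

/-- The `i`-th rank-`k` (column) ridge leverage score
`τ_i^k(M) = m_iᵀ (M Mᵀ + (‖M - M_k‖_F² / k) I)⁺ m_i`, where `m_i` is the `i`-th column of `M`. -/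
noncomputable def ridgeScore {m n : ℕ} (M : Matrix (Fin m) (Fin n) ℝ) (k : ℕ) (i : Fin n) : ℝ :=
  M.col i ⬝ᵥ
    Matrix.mulVec
      (pinv (M * M.transpose + (lowRankErrSq M k / k) • (1 : Matrix (Fin m) (Fin m) ℝ)))
      (M.col i)

open scoped MatrixOrder in
/-- The positive semidefinite square root `A^{1/2}` of a positive semidefinite matrix. -/
noncomputable def psdSqrt {n : ℕ} (A : Matrix (Fin n) (Fin n) ℝ) : Matrix (Fin n) (Fin n) ℝ :=
  CFC.sqrt A

/-- The rank parameter `k' = ⌈c k / ε²⌉`. -/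
noncomputable def rankParam (c ε : ℝ) (k : ℕ) : ℕ := ⌈c * k / ε ^ 2⌉₊

/-- The scaled scores `ℓ_i = 4 ε √(n/k) τ_i`. -/
noncomputable def scaledScore {n : ℕ} (ε : ℝ) (k : ℕ) (τ : Fin n → ℝ) (i : Fin n) : ℝ :=
  4 * ε * √((n : ℝ) / k) * τ i

/-- The sampling probabilities `p_i = ℓ_i / ∑ ℓ_i`. -/
noncomputable def sampleProb {n : ℕ} (ℓ : Fin n → ℝ) (i : Fin n) : ℝ := ℓ i / ∑ j, ℓ j

/-- The number of samples `t = ⌈(c' log n / ε²) ∑ ℓ_i⌉`. -/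
noncomputable def sampleCount {n : ℕ} (c' ε : ℝ) (ℓ : Fin n → ℝ) : ℕ :=
  ⌈c' * Real.log n / ε ^ 2 * ∑ i, ℓ i⌉₊

/-- The weighted sampling matrix whose `j`-th column is `e_i / √(t p_i)`, where `i = s j` is the
`j`-th sampled index. -/
noncomputable def samplingMatrix {n t : ℕ} (p : Fin n → ℝ) (s : Fin t → Fin n) :
    Matrix (Fin n) (Fin t) ℝ :=
  Matrix.of fun i j => if i = s j then 1 / √(t * p i) else 0

/-- The random indices `X 0, …, X (t - 1)` are independent, each equal to `i` with
probability `p i`. -/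
structure IsIIDSample {Ω : Type*} [MeasurableSpace Ω] (μ : Measure Ω) {n t : ℕ}
    (p : Fin n → ℝ) (X : Fin t → Ω → Fin n) : Prop where
  measurable : ∀ j, Measurable (X j)
  indep : iIndepFun X μ
  law : ∀ j i, μ.real {ω | X j ω = i} = p i

/-- `B` is an `(ε, k)`-spectral projection-cost preserving sketch of `C` with additive error
`(ε / k) F`: the two-sided bound holds for every orthogonal projection `P`, of any rank. -/
def IsSpectralPCP {m n t : ℕ} (ε : ℝ) (k : ℕ) (F : ℝ) (C : Matrix (Fin n) (Fin t) ℝ)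
    (B : Matrix (Fin m) (Fin t) ℝ) : Prop :=
  ∀ P : Matrix (Fin t) (Fin t) ℝ, IsStarProjection P →
    (1 - ε) * specNorm (C * (1 - P)) ^ 2 - ε / k * F ≤ specNorm (B * (1 - P)) ^ 2 ∧
    specNorm (B * (1 - P)) ^ 2 ≤ (1 + ε) * specNorm (C * (1 - P)) ^ 2 + ε / k * F

/-!
# Spectral norm projection-cost preservation from ridge leverage score sampling

Write `A = U diag(a) Uᵀ`, `F = ‖A - A_k‖_F²`, `g = ε √(n / k)`, at least one if `n ≥ k / ε²`, and let
`r = ‖A^{1/2} - (A^{1/2})_{k'}‖_F² / k'` be the ridge parameter, so that the ridge leverage scores of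
`A^{1/2}` are `∑ₗ aₗ / (aₗ + r) Uᵢₗ²` (`ridgeScore_eq`).

*Splitting.* Split the spectrum at the threshold `h = ε √(F / k) / 10`. By Cauchy–Schwarz on the tail
of the spectrum `r ≤ g h` (`ridgeParam_le_threshold`); this uses the Eckart–Young theorem only in a
form which loses constants, `exists_heavy_set`. Let `A_H`, `A_L` be the parts of `A` with eigenvalues
above and up to `h`. The bound on `r` makes the sampling scores `4 g τᵢ` dominate twice the leverage
scores of the range of `A_H`, and, up to a factor `h / 2`, the squared row norms of `A_L^{1/2}`
(`highPart_row_le`, `lowPart_row_le`). Hence with high probability a sampling matrix `S` is an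
`ε / 4`-embedding of the range of `A_H` (`measureReal_not_embedding_le`) and satisfies
`‖Sᵀ A_L^{1/2}‖² ≤ 4 h` (`measureReal_not_bounded_le`). Given the first property for `S₂` and the second
for `S₁` and `S₂`, split `A S₁ x` into its high and low part: the former is preserved by `S₂ᵀ`, the
latter has norm at most `4 h ‖x‖` before and after applying `S₂ᵀ`, and `h² / ε` is a small multiple of
`ε F / k` (`sketch_bounds`). This holds for all `x`, so it passes to all projections
(`mul_specNorm_sq_le`). Only events about a single `Sᵢ` are used, so their coupling is irrelevant.

*Concentration.* The tail bounds are matrix Chernoff bounds for sums `M` of independent rank-one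
matrices (`chernoff_upper`, `chernoff_lower`). In place of the trace exponential the potential is
`tr N ^ (q + 1)` with `N` equal to `(q + 1) I + M` or `Q I - M`, and `q → ∞` at the end; this avoids the
Golden–Thompson inequality. One rank-one step is controlled by Klein's inequality for powers
(`trace_pow_tangent_le`) and by `quadForm_pow_add_vecMulVec_le`: adding `v vᵀ` to `N ≥ c I` multiplies
the moment `vᵀ N^q v` by at most `(1 + ‖v‖² / c) ^ q`.

*Sample count.* By `exists_heavy_set` for `A^{1/2}`, the ridge leverage scores sum to at most `4 k'`
(`sum_ridgeScore_le`).
-/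

open scoped Matrix

/-! ### Orthogonal diagonalization of symmetric matrices -/

/-- `N = U diag(e) Uᵀ` with `U` orthogonal: the columns of `U` are an orthonormal basis of
eigenvectors of `N`, with eigenvalues `e`. -/
structure IsOrthDiag {ι : Type*} [Fintype ι] [DecidableEq ι] (N U : Matrix ι ι ℝ) (e : ι → ℝ) :
    Prop where
  transpose_mul : Uᵀ * U = 1
  eq : N = U * Matrix.diagonal e * Uᵀ

namespace IsOrthDiag

variable {ι : Type*} [Fintype ι] [DecidableEq ι] {N U : Matrix ι ι ℝ} {e : ι → ℝ}

theorem mul_transpose (h : IsOrthDiag N U e) : U * Uᵀ = 1 :=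
  mul_eq_one_comm.mp h.transpose_mul

theorem map (h : IsOrthDiag N U e) (f : ι → ℝ) :
    IsOrthDiag (U * Matrix.diagonal f * Uᵀ) U f := ⟨h.transpose_mul, rfl⟩

theorem mul {N' : Matrix ι ι ℝ} {e' : ι → ℝ} (h : IsOrthDiag N U e) (h' : IsOrthDiag N' U e') :
    IsOrthDiag (N * N') U (fun k => e k * e' k) := by
  refine ⟨h.transpose_mul, ?_⟩
  rw [h.eq, h'.eq, ← Matrix.diagonal_mul_diagonal]
  calc U * Matrix.diagonal e * Uᵀ * (U * Matrix.diagonal e' * Uᵀ)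
      = U * Matrix.diagonal e * (Uᵀ * U) * Matrix.diagonal e' * Uᵀ := by
        simp only [Matrix.mul_assoc]
    _ = _ := by rw [h.transpose_mul]; simp only [Matrix.mul_assoc, Matrix.mul_one]

theorem one (h : IsOrthDiag N U e) : IsOrthDiag 1 U (fun _ => 1) := by
  refine ⟨h.transpose_mul, ?_⟩
  rw [Matrix.diagonal_one, Matrix.mul_one, h.mul_transpose]

theorem pow (h : IsOrthDiag N U e) (q : ℕ) : IsOrthDiag (N ^ q) U (fun k => e k ^ q) := by
  induction q with
  | zero => simpa using h.one
  | succ q ih => simpa only [pow_succ] using ih.mul h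

theorem transpose_eq (h : IsOrthDiag N U e) : Nᵀ = N := by
  rw [h.eq]
  simp [Matrix.transpose_mul, Matrix.mul_assoc]

theorem trace (h : IsOrthDiag N U e) : N.trace = ∑ k, e k := by
  rw [h.eq, Matrix.trace_mul_comm, ← Matrix.mul_assoc, h.transpose_mul, Matrix.one_mul,
    Matrix.trace_diagonal]

theorem quadForm (h : IsOrthDiag N U e) (v : ι → ℝ) :
    v ⬝ᵥ N *ᵥ v = ∑ k, e k * (Uᵀ *ᵥ v) k ^ 2 := by
  rw [h.eq, ← Matrix.mulVec_mulVec, ← Matrix.mulVec_mulVec, Matrix.dotProduct_mulVec,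
    ← Matrix.mulVec_transpose]
  simp only [dotProduct, Matrix.mulVec_diagonal]
  exact Finset.sum_congr rfl fun k _ => by ring

theorem dotProduct_self (h : IsOrthDiag N U e) (v : ι → ℝ) :
    v ⬝ᵥ v = ∑ k, (Uᵀ *ᵥ v) k ^ 2 := by
  simpa using h.one.quadForm v

theorem transpose_mulVec_col (h : IsOrthDiag N U e) (k : ι) :
    Uᵀ *ᵥ (fun i => U i k) = Pi.single k 1 := by
  ext l
  have := congrFun (congrFun h.transpose_mul l) k
  rw [Matrix.mul_apply] at this
  simp only [Matrix.mulVec, dotProduct, this, Matrix.one_apply, Pi.single_apply]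

theorem quadForm_col (h : IsOrthDiag N U e) (k : ι) :
    (fun i => U i k) ⬝ᵥ N *ᵥ (fun i => U i k) = e k := by
  rw [h.quadForm, h.transpose_mulVec_col]
  simp [Pi.single_apply]

theorem dotProduct_col (h : IsOrthDiag N U e) (k : ι) :
    (fun i => U i k) ⬝ᵥ (fun i => U i k) = 1 := by
  simpa using h.one.quadForm_col k

theorem transpose_apply_sum (h : IsOrthDiag N U e) (i j : ι) :
    ∑ l, U l i * U l j = if i = j then 1 else 0 := by
  have := congrFun (congrFun h.transpose_mul i) j
  rw [Matrix.mul_apply, Matrix.one_apply] at this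
  exact this

end IsOrthDiag

theorem exists_isOrthDiag {ι : Type*} [Fintype ι] [DecidableEq ι] {N : Matrix ι ι ℝ}
    (hN : Nᵀ = N) : ∃ U e, IsOrthDiag N U e := by
  have hH : N.IsHermitian := by
    rw [Matrix.IsHermitian, Matrix.conjTranspose_eq_transpose_of_trivial, hN]
  have hs : star (hH.eigenvectorUnitary : Matrix ι ι ℝ)
      = (hH.eigenvectorUnitary : Matrix ι ι ℝ)ᵀ := by
    rw [Matrix.star_eq_conjTranspose, Matrix.conjTranspose_eq_transpose_of_trivial]
  refine ⟨hH.eigenvectorUnitary, hH.eigenvalues, ?_, ?_⟩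
  · rw [← hs]; exact Unitary.coe_star_mul_self _
  · have := hH.spectral_theorem
    rw [Unitary.conjStarAlgAut_apply, hs] at this
    simpa [Function.comp_def] using this

/-! ### Trace inequalities for powers -/

theorem dotProduct_self_nonneg {ι : Type*} [Fintype ι] (v : ι → ℝ) : 0 ≤ v ⬝ᵥ v :=
  Finset.sum_nonneg fun _ _ => mul_self_nonneg _

theorem trace_mul_vecMulVec {ι : Type*} [Fintype ι] (M : Matrix ι ι ℝ) (v : ι → ℝ) :
    (M * Matrix.vecMulVec v v).trace = v ⬝ᵥ M *ᵥ v := by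
  rw [Matrix.mul_vecMulVec, Matrix.trace_vecMulVec, dotProduct_comm]

theorem quadForm_vecMulVec {ι : Type*} [Fintype ι] (v x : ι → ℝ) :
    x ⬝ᵥ Matrix.vecMulVec v v *ᵥ x = (v ⬝ᵥ x) ^ 2 := by
  rw [Matrix.vecMulVec_mulVec]
  simp [dotProduct_smul, dotProduct_comm x v, sq]

theorem transpose_vecMulVec_self {ι : Type*} (v : ι → ℝ) :
    (Matrix.vecMulVec v v)ᵀ = Matrix.vecMulVec v v := by
  rw [Matrix.transpose_vecMulVec]

section Powers

variable {ι : Type*} [Fintype ι] [DecidableEq ι]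

/-- `c I ≤ N`, as an inequality of quadratic forms. -/
def FormGE (N : Matrix ι ι ℝ) (c : ℝ) : Prop := ∀ x : ι → ℝ, c * (x ⬝ᵥ x) ≤ x ⬝ᵥ N *ᵥ x

/-- `N ≤ c I`, as an inequality of quadratic forms. -/
def FormLE (N : Matrix ι ι ℝ) (c : ℝ) : Prop := ∀ x : ι → ℝ, x ⬝ᵥ N *ᵥ x ≤ c * (x ⬝ᵥ x)

variable {N U : Matrix ι ι ℝ} {e : ι → ℝ} {c : ℝ}

theorem FormGE.le_eigenvalue (h : FormGE N c) (hd : IsOrthDiag N U e) (k : ι) : c ≤ e k := by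
  have := h (fun i => U i k)
  rwa [hd.quadForm_col, hd.dotProduct_col, mul_one] at this

theorem FormLE.eigenvalue_le (h : FormLE N c) (hd : IsOrthDiag N U e) (k : ι) : e k ≤ c := by
  have := h (fun i => U i k)
  rwa [hd.quadForm_col, hd.dotProduct_col, mul_one] at this

theorem quadForm_pow_nonneg (hd : IsOrthDiag N U e) (hc : 0 ≤ c) (h : FormGE N c) (q : ℕ)
    (v : ι → ℝ) : 0 ≤ v ⬝ᵥ (N ^ q) *ᵥ v := by
  rw [(hd.pow q).quadForm]
  exact Finset.sum_nonneg fun k _ =>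
    mul_nonneg (pow_nonneg (hc.trans (h.le_eigenvalue hd k)) _) (sq_nonneg _)

theorem mul_quadForm_pow_le (hN : Nᵀ = N) (hc : 0 ≤ c) (h : FormGE N c) (q : ℕ) (v : ι → ℝ) :
    c * (v ⬝ᵥ (N ^ q) *ᵥ v) ≤ v ⬝ᵥ (N ^ (q + 1)) *ᵥ v := by
  obtain ⟨U, e, hd⟩ := exists_isOrthDiag hN
  rw [(hd.pow q).quadForm, (hd.pow (q + 1)).quadForm, Finset.mul_sum]
  refine Finset.sum_le_sum fun k _ => ?_
  have hk := h.le_eigenvalue hd k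
  rw [← mul_assoc, pow_succ' (e k)]
  exact mul_le_mul_of_nonneg_right
    (mul_le_mul_of_nonneg_right hk (pow_nonneg (hc.trans hk) _)) (sq_nonneg _)

theorem mul_trace_pow_le (hN : Nᵀ = N) (hc : 0 ≤ c) (h : FormGE N c) (q : ℕ) :
    c * (N ^ q).trace ≤ (N ^ (q + 1)).trace := by
  obtain ⟨U, e, hd⟩ := exists_isOrthDiag hN
  rw [(hd.pow q).trace, (hd.pow (q + 1)).trace, Finset.mul_sum]
  refine Finset.sum_le_sum fun k _ => ?_
  have hk := h.le_eigenvalue hd k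
  rw [pow_succ']
  exact mul_le_mul_of_nonneg_right hk (pow_nonneg (hc.trans hk) _)

theorem trace_pow_succ_le (hN : Nᵀ = N) (h0 : FormGE N 0) (h : FormLE N c) (q : ℕ) :
    (N ^ (q + 1)).trace ≤ c * (N ^ q).trace := by
  obtain ⟨U, e, hd⟩ := exists_isOrthDiag hN
  rw [(hd.pow q).trace, (hd.pow (q + 1)).trace, Finset.mul_sum]
  refine Finset.sum_le_sum fun k _ => ?_
  rw [pow_succ']
  exact mul_le_mul_of_nonneg_right (h.eigenvalue_le hd k) (pow_nonneg (h0.le_eigenvalue hd k) _)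

theorem trace_pow_nonneg (hN : Nᵀ = N) (h0 : FormGE N 0) (q : ℕ) : 0 ≤ (N ^ q).trace := by
  obtain ⟨U, e, hd⟩ := exists_isOrthDiag hN
  rw [(hd.pow q).trace]
  exact Finset.sum_nonneg fun k _ => pow_nonneg (h0.le_eigenvalue hd k) _

/-- A large value of the quadratic form makes the trace of every power large. -/
theorem pow_le_trace_pow (hN : Nᵀ = N) (h0 : FormGE N 0) (hc : 0 ≤ c) (h : ¬ FormLE N c)
    (q : ℕ) : c ^ q ≤ (N ^ q).trace := by
  obtain ⟨U, e, hd⟩ := exists_isOrthDiag hN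
  have : ∃ k, c < e k := by
    by_contra! hle
    refine h fun x => ?_
    rw [hd.quadForm, hd.dotProduct_self, Finset.mul_sum]
    exact Finset.sum_le_sum fun k _ => mul_le_mul_of_nonneg_right (hle k) (sq_nonneg _)
  obtain ⟨k, hk⟩ := this
  rw [(hd.pow q).trace]
  exact (pow_le_pow_left₀ hc hk.le q).trans
    (Finset.single_le_sum (f := fun k => e k ^ q)
      (fun k _ => pow_nonneg (h0.le_eigenvalue hd k) _) (Finset.mem_univ k))

/-- Chebyshev's sum inequality for two powers of nonnegative numbers. -/
theorem pow_mul_pow_add_le {x y : ℝ} (hx : 0 ≤ x) (hy : 0 ≤ y) (a b : ℕ) :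
    x ^ a * y ^ b + x ^ b * y ^ a ≤ x ^ (a + b) + y ^ (a + b) := by
  have : 0 ≤ (x ^ a - y ^ a) * (x ^ b - y ^ b) := by
    rcases le_total x y with h | h
    · exact mul_nonneg_of_nonpos_of_nonpos (sub_nonpos.2 (pow_le_pow_left₀ hx h a))
        (sub_nonpos.2 (pow_le_pow_left₀ hx h b))
    · exact mul_nonneg (sub_nonneg.2 (pow_le_pow_left₀ hy h a))
        (sub_nonneg.2 (pow_le_pow_left₀ hy h b))
  rw [pow_add, pow_add]
  linarith

/-- The moments `vᵀ N^q v` of a positive semidefinite matrix are positively correlated. -/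
theorem quadForm_pow_mul_le (hN : Nᵀ = N) (h0 : FormGE N 0) (a b : ℕ) (v : ι → ℝ) :
    (v ⬝ᵥ (N ^ a) *ᵥ v) * (v ⬝ᵥ (N ^ b) *ᵥ v) ≤ (v ⬝ᵥ v) * (v ⬝ᵥ (N ^ (a + b)) *ᵥ v) := by
  obtain ⟨U, e, hd⟩ := exists_isOrthDiag hN
  rw [(hd.pow a).quadForm, (hd.pow b).quadForm, (hd.pow (a + b)).quadForm, hd.dotProduct_self]
  set w : ι → ℝ := fun k => (Uᵀ *ᵥ v) k ^ 2 with hw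
  have hw0 : ∀ k, 0 ≤ w k := fun k => sq_nonneg _
  have e1 : ∀ a b : ℕ, (∑ k, e k ^ a * w k) * (∑ k, e k ^ b * w k)
      = ∑ k, ∑ l, w k * w l * (e k ^ a * e l ^ b) := fun a b => by
    rw [Finset.sum_mul_sum]
    exact Finset.sum_congr rfl fun k _ => Finset.sum_congr rfl fun l _ => by ring
  have s1 := e1 a b
  have s2 := e1 b a
  have s3 := e1 (a + b) 0
  have s4 := e1 0 (a + b)
  simp only [pow_zero, one_mul, mul_one] at s3 s4
  have key : ∑ k, ∑ l, w k * w l * (e k ^ a * e l ^ b) + ∑ k, ∑ l, w k * w l * (e k ^ b * e l ^ a)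
      ≤ ∑ k, ∑ l, w k * w l * (e k ^ (a + b)) + ∑ k, ∑ l, w k * w l * (e l ^ (a + b)) := by
    simp only [← Finset.sum_add_distrib, ← mul_add]
    exact Finset.sum_le_sum fun k _ => Finset.sum_le_sum fun l _ =>
      mul_le_mul_of_nonneg_left
        (pow_mul_pow_add_le (h0.le_eigenvalue hd k) (h0.le_eigenvalue hd l) a b)
        (mul_nonneg (hw0 k) (hw0 l))
  linarith [mul_comm (∑ k, e k ^ a * w k) (∑ k, e k ^ b * w k),
    mul_comm (∑ k, w k) (∑ k, e k ^ (a + b) * w k)]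

/-- The tangent line inequality for `x ↦ x ^ (q + 1)` on the nonnegative reals. -/
theorem tangent_pow_le {x y : ℝ} (hx : 0 ≤ x) (hy : 0 ≤ y) (q : ℕ) :
    x ^ (q + 1) + (q + 1) * (x ^ q * (y - x)) ≤ y ^ (q + 1) := by
  induction q with
  | zero => simp
  | succ q ih =>
    have h1 := mul_le_mul_of_nonneg_right ih hy
    have h2 : 0 ≤ (q + 1) * (x ^ q * (y - x) ^ 2) := by positivity
    push_cast
    calc x ^ (q + 1 + 1) + (q + 1 + 1) * (x ^ (q + 1) * (y - x))
        ≤ (x ^ (q + 1) + (q + 1) * (x ^ q * (y - x))) * y := by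
          rw [← sub_nonneg]; refine h2.trans (le_of_eq ?_); ring
      _ ≤ y ^ (q + 1) * y := h1
      _ = y ^ (q + 1 + 1) := by ring

/-- In two orthonormal eigenbases `U`, `W`, traces of products are weighted sums with the doubly
stochastic weights `(UᵀW)ᵢⱼ²`. -/
theorem IsOrthDiag.trace_mul {N' W : Matrix ι ι ℝ} {f : ι → ℝ} (h : IsOrthDiag N U e)
    (h' : IsOrthDiag N' W f) :
    (N * N').trace = ∑ i, ∑ j, e i * f j * (Uᵀ * W) i j ^ 2 := by
  have : (N * N').trace
      = (Matrix.diagonal e * (Uᵀ * W) * Matrix.diagonal f * (Uᵀ * W)ᵀ).trace := by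
    rw [h.eq, h'.eq, Matrix.transpose_mul, Matrix.transpose_transpose]
    calc (U * Matrix.diagonal e * Uᵀ * (W * Matrix.diagonal f * Wᵀ)).trace
        = (U * (Matrix.diagonal e * Uᵀ * W * Matrix.diagonal f * Wᵀ)).trace := by
          simp only [Matrix.mul_assoc]
      _ = _ := by rw [Matrix.trace_mul_comm]; simp only [Matrix.mul_assoc]
  rw [this]
  simp only [Matrix.trace, Matrix.diag, Matrix.mul_apply (N := (Uᵀ * W)ᵀ), Matrix.mul_diagonal,
    Matrix.diagonal_mul, Matrix.transpose_apply (Uᵀ * W)]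
  exact Finset.sum_congr rfl fun i _ => Finset.sum_congr rfl fun j _ => by ring

/-- Klein's inequality for the convex function `x ↦ x ^ (q + 1)`. -/
theorem trace_pow_tangent_le {X Y : Matrix ι ι ℝ} (hX : Xᵀ = X) (hY : Yᵀ = Y)
    (hX0 : FormGE X 0) (hY0 : FormGE Y 0) (q : ℕ) :
    (X ^ (q + 1)).trace + (q + 1) * (X ^ q * (Y - X)).trace ≤ (Y ^ (q + 1)).trace := by
  obtain ⟨U, e, hd⟩ := exists_isOrthDiag hX
  obtain ⟨W, f, hd'⟩ := exists_isOrthDiag hY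
  have t1 := (hd.pow (q + 1)).trace_mul hd'.one
  have t2 := (hd.pow q).trace_mul hd'
  have t3 := hd.one.trace_mul (hd'.pow (q + 1))
  rw [Matrix.mul_one] at t1
  rw [Matrix.one_mul] at t3
  rw [Matrix.mul_sub, Matrix.trace_sub, ← pow_succ, t1, t2, t3]
  simp only [Finset.mul_sum, ← Finset.sum_add_distrib, ← Finset.sum_sub_distrib]
  refine Finset.sum_le_sum fun i _ => Finset.sum_le_sum fun j _ => ?_
  have := mul_le_mul_of_nonneg_right
    (tangent_pow_le (hX0.le_eigenvalue hd i) (hY0.le_eigenvalue hd' j) q)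
    (sq_nonneg ((Uᵀ * W) i j))
  refine le_trans (le_of_eq ?_) (this.trans (le_of_eq ?_)) <;> ring

theorem pow_sub_pow_telescope (X Y : Matrix ι ι ℝ) (q : ℕ) :
    Y ^ q - X ^ q = ∑ a ∈ Finset.range q, Y ^ a * (Y - X) * X ^ (q - 1 - a) := by
  induction q with
  | zero => simp
  | succ q ih =>
    have : ∑ a ∈ Finset.range q, Y ^ a * (Y - X) * X ^ (q + 1 - 1 - a)
        = (∑ a ∈ Finset.range q, Y ^ a * (Y - X) * X ^ (q - 1 - a)) * X := by
      rw [Finset.sum_mul]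
      refine Finset.sum_congr rfl fun a ha => ?_
      rw [Finset.mem_range] at ha
      rw [Matrix.mul_assoc _ _ X, ← pow_succ]
      congr 2
      omega
    rw [Finset.sum_range_succ, this, ← ih]
    simp only [Nat.add_sub_cancel, Nat.sub_self, pow_zero, Matrix.mul_one, pow_succ,
      Matrix.mul_sub, Matrix.sub_mul]
    abel

/-- The moments `vᵀ N^q v` grow at most by the factor `(1 + L / c) ^ q` when `v vᵀ`, with
`‖v‖² ≤ L`, is added to `N ≥ c I`. -/
theorem quadForm_pow_add_vecMulVec_le (hN : Nᵀ = N) (hc : 0 < c) (h : FormGE N c) {L : ℝ}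
    {v : ι → ℝ} (hv : v ⬝ᵥ v ≤ L) (q : ℕ) :
    v ⬝ᵥ ((N + Matrix.vecMulVec v v) ^ q) *ᵥ v ≤ (1 + L / c) ^ q * (v ⬝ᵥ (N ^ q) *ᵥ v) := by
  have h0 : FormGE N 0 := fun x => by
    rw [zero_mul]
    exact le_trans (mul_nonneg hc.le (dotProduct_self_nonneg x)) (h x)
  obtain ⟨U, e, hd⟩ := exists_isOrthDiag hN
  have hL : 0 ≤ L := le_trans (dotProduct_self_nonneg v) hv
  have hpos : ∀ a, 0 ≤ v ⬝ᵥ (N ^ a) *ᵥ v := fun a => quadForm_pow_nonneg hd le_rfl h0 a v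
  have hr : 0 ≤ 1 + L / c := by positivity
  induction q using Nat.strong_induction_on with
  | _ q ih =>
    have tele := congrArg (fun M => v ⬝ᵥ M *ᵥ v)
      (pow_sub_pow_telescope N (N + Matrix.vecMulVec v v) q)
    simp only [add_sub_cancel_left, Matrix.sub_mulVec, dotProduct_sub, Matrix.sum_mulVec,
      dotProduct_sum] at tele
    have term : ∀ a ∈ Finset.range q,
        v ⬝ᵥ ((N + Matrix.vecMulVec v v) ^ a * Matrix.vecMulVec v v * N ^ (q - 1 - a)) *ᵥ v
          ≤ (L / c) * (1 + L / c) ^ a * (v ⬝ᵥ (N ^ q) *ᵥ v) := by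
      intro a ha
      rw [Finset.mem_range] at ha
      have e1 : v ⬝ᵥ ((N + Matrix.vecMulVec v v) ^ a * Matrix.vecMulVec v v * N ^ (q - 1 - a)) *ᵥ v
          = (v ⬝ᵥ ((N + Matrix.vecMulVec v v) ^ a) *ᵥ v) * (v ⬝ᵥ (N ^ (q - 1 - a)) *ᵥ v) := by
        rw [← Matrix.mulVec_mulVec, ← Matrix.mulVec_mulVec, Matrix.vecMulVec_mulVec]
        simp [Matrix.mulVec_smul, dotProduct_smul, mul_comm]
      have e2 := quadForm_pow_mul_le hN h0 a (q - 1 - a) v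
      have e3 : a + (q - 1 - a) = q - 1 := by omega
      have e4 := mul_quadForm_pow_le hN hc.le h (q - 1) v
      have e5 : q - 1 + 1 = q := by omega
      rw [e3] at e2
      rw [e5] at e4
      rw [e1]
      have e6 : (v ⬝ᵥ v) * (v ⬝ᵥ (N ^ (q - 1)) *ᵥ v) ≤ L / c * (v ⬝ᵥ (N ^ q) *ᵥ v) := by
        calc (v ⬝ᵥ v) * (v ⬝ᵥ (N ^ (q - 1)) *ᵥ v) ≤ L * (v ⬝ᵥ (N ^ (q - 1)) *ᵥ v) :=
              mul_le_mul_of_nonneg_right hv (hpos _)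
          _ = L / c * (c * (v ⬝ᵥ (N ^ (q - 1)) *ᵥ v)) := by field_simp
          _ ≤ _ := mul_le_mul_of_nonneg_left e4 (by positivity)
      calc _ ≤ (1 + L / c) ^ a * (v ⬝ᵥ (N ^ a) *ᵥ v) * (v ⬝ᵥ (N ^ (q - 1 - a)) *ᵥ v) :=
            mul_le_mul_of_nonneg_right (ih a ha) (hpos _)
        _ = (1 + L / c) ^ a * ((v ⬝ᵥ (N ^ a) *ᵥ v) * (v ⬝ᵥ (N ^ (q - 1 - a)) *ᵥ v)) := by ring
        _ ≤ (1 + L / c) ^ a * (L / c * (v ⬝ᵥ (N ^ q) *ᵥ v)) :=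
            mul_le_mul_of_nonneg_left (e2.trans e6) (by positivity)
        _ = _ := by ring
    have tot := Finset.sum_le_sum term
    have geo : ∑ a ∈ Finset.range q, (L / c) * (1 + L / c) ^ a * (v ⬝ᵥ (N ^ q) *ᵥ v)
        = ((1 + L / c) ^ q - 1) * (v ⬝ᵥ (N ^ q) *ᵥ v) := by
      rw [← Finset.sum_mul, ← Finset.mul_sum]
      congr 1
      have := mul_geom_sum (1 + L / c) q
      rwa [add_sub_cancel_left] at this
    linarith

theorem one_add_div_pow_le_exp {L : ℝ} (hL : 0 ≤ L) (q : ℕ) :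
    (1 + L / (q + 1)) ^ q ≤ Real.exp L := by
  have h1 : 1 + L / (q + 1) ≤ Real.exp (L / (q + 1)) := by
    linarith [Real.add_one_le_exp (L / ((q : ℝ) + 1))]
  calc (1 + L / (q + 1)) ^ q ≤ Real.exp (L / (q + 1)) ^ q :=
        pow_le_pow_left₀ (by positivity) h1 q
    _ = Real.exp (q * (L / (q + 1))) := by rw [← Real.exp_nat_mul]
    _ ≤ Real.exp L := by
        apply Real.exp_le_exp.2
        rw [← mul_div_assoc, div_le_iff₀ (by positivity)]
        nlinarith

/-- Rank-one update of the trace of a power: Klein's inequality bounds the increment by the moment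
of the updated matrix, which is at most `exp L` times that of `N`. -/
theorem trace_pow_add_vecMulVec_le {q : ℕ} (hN : Nᵀ = N) (h : FormGE N (q + 1)) {L : ℝ}
    {v : ι → ℝ} (hv : v ⬝ᵥ v ≤ L) :
    ((N + Matrix.vecMulVec v v) ^ (q + 1)).trace
      ≤ (N ^ (q + 1)).trace + (q + 1) * Real.exp L * (v ⬝ᵥ (N ^ q) *ᵥ v) := by
  have hL : 0 ≤ L := le_trans (dotProduct_self_nonneg v) hv
  have h0 : FormGE N 0 := fun x => by
    rw [zero_mul]
    exact le_trans (mul_nonneg (by positivity) (dotProduct_self_nonneg x)) (h x)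
  have hN1 : (N + Matrix.vecMulVec v v)ᵀ = N + Matrix.vecMulVec v v := by
    rw [Matrix.transpose_add, hN, transpose_vecMulVec_self]
  have h1 : FormGE (N + Matrix.vecMulVec v v) 0 := fun x => by
    rw [Matrix.add_mulVec, dotProduct_add, quadForm_vecMulVec]
    linarith [h0 x, sq_nonneg (v ⬝ᵥ x)]
  obtain ⟨U, e, hd⟩ := exists_isOrthDiag hN
  have klein := trace_pow_tangent_le hN1 hN h1 h0 q
  rw [sub_add_cancel_left, Matrix.mul_neg, Matrix.trace_neg, trace_mul_vecMulVec] at klein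
  have g := quadForm_pow_add_vecMulVec_le hN (by positivity) h hv q
  have g2 : v ⬝ᵥ ((N + Matrix.vecMulVec v v) ^ q) *ᵥ v ≤ Real.exp L * (v ⬝ᵥ (N ^ q) *ᵥ v) :=
    g.trans (mul_le_mul_of_nonneg_right (one_add_div_pow_le_exp hL q)
      (quadForm_pow_nonneg hd le_rfl h0 q v))
  have : ((q : ℝ) + 1) * (v ⬝ᵥ ((N + Matrix.vecMulVec v v) ^ q) *ᵥ v)
      ≤ (q + 1) * (Real.exp L * (v ⬝ᵥ (N ^ q) *ᵥ v)) :=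
    mul_le_mul_of_nonneg_left g2 (by positivity)
  linarith

/-- Rank-one downdate of the trace of a power, the mirror image of `trace_pow_add_vecMulVec_le`. -/
theorem trace_pow_sub_vecMulVec_le {q : ℕ} (hN : Nᵀ = N) {L : ℝ}
    {v : ι → ℝ} (h : FormGE (N - Matrix.vecMulVec v v) (q + 1)) (hv : v ⬝ᵥ v ≤ L) :
    ((N - Matrix.vecMulVec v v) ^ (q + 1)).trace
      ≤ (N ^ (q + 1)).trace - (q + 1) * Real.exp (-L) * (v ⬝ᵥ (N ^ q) *ᵥ v) := by
  have hL : 0 ≤ L := le_trans (dotProduct_self_nonneg v) hv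
  have h0 : FormGE (N - Matrix.vecMulVec v v) 0 := fun x => by
    rw [zero_mul]
    exact le_trans (mul_nonneg (by positivity) (dotProduct_self_nonneg x)) (h x)
  have hN1 : (N - Matrix.vecMulVec v v)ᵀ = N - Matrix.vecMulVec v v := by
    rw [Matrix.transpose_sub, hN, transpose_vecMulVec_self]
  have h1 : FormGE N 0 := fun x => by
    have := h0 x
    rw [Matrix.sub_mulVec, dotProduct_sub, quadForm_vecMulVec] at this
    linarith [sq_nonneg (v ⬝ᵥ x)]
  obtain ⟨U, e, hd⟩ := exists_isOrthDiag hN1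
  have klein := trace_pow_tangent_le hN1 hN h0 h1 q
  rw [sub_sub_cancel, trace_mul_vecMulVec] at klein
  have g := quadForm_pow_add_vecMulVec_le hN1 (by positivity) h hv q
  rw [sub_add_cancel] at g
  have g2 : v ⬝ᵥ (N ^ q) *ᵥ v ≤ Real.exp L * (v ⬝ᵥ ((N - Matrix.vecMulVec v v) ^ q) *ᵥ v) :=
    g.trans (mul_le_mul_of_nonneg_right (one_add_div_pow_le_exp hL q)
      (quadForm_pow_nonneg hd le_rfl h0 q v))
  have g3 : Real.exp (-L) * (v ⬝ᵥ (N ^ q) *ᵥ v)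
      ≤ v ⬝ᵥ ((N - Matrix.vecMulVec v v) ^ q) *ᵥ v := by
    rw [Real.exp_neg, inv_mul_le_iff₀ (Real.exp_pos L)]
    exact g2
  have : ((q : ℝ) + 1) * (Real.exp (-L) * (v ⬝ᵥ (N ^ q) *ᵥ v))
      ≤ (q + 1) * (v ⬝ᵥ ((N - Matrix.vecMulVec v v) ^ q) *ᵥ v) :=
    mul_le_mul_of_nonneg_left g3 (by positivity)
  linarith

end Powers

/-! ### Chernoff bounds for sums of independent rank-one matrices -/

theorem sq_dotProduct_le {ι : Type*} [Fintype ι] (v x : ι → ℝ) :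
    (v ⬝ᵥ x) ^ 2 ≤ (v ⬝ᵥ v) * (x ⬝ᵥ x) := by
  simpa only [dotProduct, sq] using Finset.sum_mul_sq_le_sq_mul_sq Finset.univ v x

theorem FormGE.mono {ι : Type*} [Fintype ι] {N : Matrix ι ι ℝ} {c d : ℝ} (h : FormGE N c)
    (hd : d ≤ c) : FormGE N d :=
  fun x => (mul_le_mul_of_nonneg_right hd (dotProduct_self_nonneg x)).trans (h x)

theorem quadForm_sum_vecMulVec {ι κ : Type*} [Fintype ι] {t : ℕ} (v : κ → ι → ℝ) (s : Fin t → κ)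
    (x : ι → ℝ) :
    x ⬝ᵥ (∑ j, Matrix.vecMulVec (v (s j)) (v (s j))) *ᵥ x = ∑ j, (v (s j) ⬝ᵥ x) ^ 2 := by
  rw [Matrix.sum_mulVec, dotProduct_sum]
  exact Finset.sum_congr rfl fun j _ => quadForm_vecMulVec _ _

theorem transpose_sum_vecMulVec {ι κ : Type*} {t : ℕ} (v : κ → ι → ℝ) (s : Fin t → κ) :
    (∑ j, Matrix.vecMulVec (v (s j)) (v (s j)))ᵀ = ∑ j, Matrix.vecMulVec (v (s j)) (v (s j)) := by
  rw [Matrix.transpose_sum]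
  exact Finset.sum_congr rfl fun j _ => transpose_vecMulVec_self _

theorem smul_sqrt_dotProduct_sq {ι : Type*} [Fintype ι] {θ : ℝ} (hθ : 0 ≤ θ) (u x : ι → ℝ) :
    ((√θ • u) ⬝ᵥ x) ^ 2 = θ * (u ⬝ᵥ x) ^ 2 := by
  rw [smul_dotProduct, smul_eq_mul, mul_pow, Real.sq_sqrt hθ]

section Chernoff

variable {ι κ : Type*} [Fintype ι] [DecidableEq ι] [Fintype κ] {p : κ → ℝ} {v : κ → ι → ℝ}
  {L β : ℝ}

theorem sum_mul_quadForm_pow (p : κ → ℝ) (v : κ → ι → ℝ) {N U : Matrix ι ι ℝ} {e : ι → ℝ}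
    (hd : IsOrthDiag N U e) (q : ℕ) :
    ∑ i, p i * (v i ⬝ᵥ (N ^ q) *ᵥ v i)
      = ∑ k, e k ^ q * ∑ i, p i * (v i ⬝ᵥ fun l => U l k) ^ 2 := by
  simp only [(hd.pow q).quadForm, Finset.mul_sum]
  rw [Finset.sum_comm]
  refine Finset.sum_congr rfl fun k _ => Finset.sum_congr rfl fun i _ => ?_
  have : (Uᵀ *ᵥ v i) k = v i ⬝ᵥ fun l => U l k := by
    rw [dotProduct_comm]; rfl
  rw [this]; ring

theorem sum_mul_quadForm_pow_le {N : Matrix ι ι ℝ} (hN : Nᵀ = N) (h0 : FormGE N 0)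
    (hβ : ∀ x, ∑ i, p i * (v i ⬝ᵥ x) ^ 2 ≤ β * (x ⬝ᵥ x)) (q : ℕ) :
    ∑ i, p i * (v i ⬝ᵥ (N ^ q) *ᵥ v i) ≤ β * (N ^ q).trace := by
  obtain ⟨U, e, hd⟩ := exists_isOrthDiag hN
  rw [sum_mul_quadForm_pow p v hd, (hd.pow q).trace, Finset.mul_sum]
  refine Finset.sum_le_sum fun k _ => ?_
  have := hβ fun l => U l k
  rw [hd.dotProduct_col, mul_one] at this
  rw [mul_comm β]
  exact mul_le_mul_of_nonneg_left this (pow_nonneg (h0.le_eigenvalue hd k) _)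

theorem le_sum_mul_quadForm_pow {N : Matrix ι ι ℝ} (hN : Nᵀ = N) (h0 : FormGE N 0)
    (hβ : ∀ x, β * (x ⬝ᵥ x) ≤ ∑ i, p i * (v i ⬝ᵥ x) ^ 2) (q : ℕ) :
    β * (N ^ q).trace ≤ ∑ i, p i * (v i ⬝ᵥ (N ^ q) *ᵥ v i) := by
  obtain ⟨U, e, hd⟩ := exists_isOrthDiag hN
  rw [sum_mul_quadForm_pow p v hd, (hd.pow q).trace, Finset.mul_sum]
  refine Finset.sum_le_sum fun k _ => ?_
  have := hβ fun l => U l k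
  rw [hd.dotProduct_col, mul_one] at this
  rw [mul_comm β]
  exact mul_le_mul_of_nonneg_left this (pow_nonneg (h0.le_eigenvalue hd k) _)

/-- Expected trace of a power after adding one random `v vᵀ` with `𝔼 v vᵀ ≤ β I` and `‖v‖² ≤ L`. -/
theorem sum_mul_trace_pow_add_le (hp : ∀ i, 0 ≤ p i) (hp1 : ∑ i, p i = 1)
    (hL : ∀ i, v i ⬝ᵥ v i ≤ L)
    (hβ : ∀ x, ∑ i, p i * (v i ⬝ᵥ x) ^ 2 ≤ β * (x ⬝ᵥ x)) (hβ0 : 0 ≤ β) {q : ℕ}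
    {N : Matrix ι ι ℝ} (hN : Nᵀ = N) (h : FormGE N (q + 1)) :
    ∑ i, p i * ((N + Matrix.vecMulVec (v i) (v i)) ^ (q + 1)).trace
      ≤ Real.exp (β * Real.exp L) * (N ^ (q + 1)).trace := by
  have h0 : FormGE N 0 := h.mono (by positivity)
  have s1 : ∑ i, p i * ((N + Matrix.vecMulVec (v i) (v i)) ^ (q + 1)).trace
      ≤ ∑ i, (p i * (N ^ (q + 1)).trace
          + (q + 1) * Real.exp L * (p i * (v i ⬝ᵥ (N ^ q) *ᵥ v i))) :=
    Finset.sum_le_sum fun i _ => by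
      have := mul_le_mul_of_nonneg_left (trace_pow_add_vecMulVec_le hN h (hL i)) (hp i)
      refine this.trans (le_of_eq ?_); ring
  rw [Finset.sum_add_distrib, ← Finset.sum_mul, hp1, one_mul, ← Finset.mul_sum] at s1
  have s2 := sum_mul_quadForm_pow_le hN h0 hβ q
  have s3 := mul_trace_pow_le hN (by positivity) h q
  have s4 : (q + 1) * Real.exp L * ∑ i, p i * (v i ⬝ᵥ (N ^ q) *ᵥ v i)
      ≤ β * Real.exp L * (N ^ (q + 1)).trace := by
    calc (q + 1) * Real.exp L * ∑ i, p i * (v i ⬝ᵥ (N ^ q) *ᵥ v i)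
        ≤ (q + 1) * Real.exp L * (β * (N ^ q).trace) :=
          mul_le_mul_of_nonneg_left s2 (by positivity)
      _ = β * Real.exp L * ((q + 1) * (N ^ q).trace) := by ring
      _ ≤ _ := mul_le_mul_of_nonneg_left s3 (by positivity)
  have s5 := mul_le_mul_of_nonneg_right (Real.add_one_le_exp (β * Real.exp L))
    (trace_pow_nonneg hN h0 (q + 1))
  linarith

/-- Expected trace of a power after subtracting one random `v vᵀ` with `𝔼 v vᵀ ≥ β I`, `‖v‖² ≤ L`.
-/
theorem sum_mul_trace_pow_sub_le (hp : ∀ i, 0 ≤ p i) (hp1 : ∑ i, p i = 1)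
    (hL : ∀ i, v i ⬝ᵥ v i ≤ L)
    (hβ : ∀ x, β * (x ⬝ᵥ x) ≤ ∑ i, p i * (v i ⬝ᵥ x) ^ 2) (hβ0 : 0 ≤ β) {q : ℕ} {Q : ℝ}
    (hQ : 0 < Q) {N : Matrix ι ι ℝ} (hN : Nᵀ = N) (h : FormGE N (q + 1 + L)) (hL0 : 0 ≤ L)
    (hle : FormLE N Q) :
    ∑ i, p i * ((N - Matrix.vecMulVec (v i) (v i)) ^ (q + 1)).trace
      ≤ Real.exp (-(β * ((q + 1) / Q) * Real.exp (-L))) * (N ^ (q + 1)).trace := by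
  have h0 : FormGE N 0 := h.mono (by positivity)
  have s1 : ∑ i, p i * ((N - Matrix.vecMulVec (v i) (v i)) ^ (q + 1)).trace
      ≤ ∑ i, (p i * (N ^ (q + 1)).trace
          - (q + 1) * Real.exp (-L) * (p i * (v i ⬝ᵥ (N ^ q) *ᵥ v i))) :=
    Finset.sum_le_sum fun i _ => by
      have hi : FormGE (N - Matrix.vecMulVec (v i) (v i)) (q + 1) := fun x => by
        rw [Matrix.sub_mulVec, dotProduct_sub, quadForm_vecMulVec]
        have c1 := sq_dotProduct_le (v i) x
        have c2 := mul_le_mul_of_nonneg_right (hL i) (dotProduct_self_nonneg x)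
        linarith [h x]
      have := mul_le_mul_of_nonneg_left (trace_pow_sub_vecMulVec_le hN hi (hL i)) (hp i)
      refine this.trans (le_of_eq ?_); ring
  rw [Finset.sum_sub_distrib, ← Finset.sum_mul, hp1, one_mul, ← Finset.mul_sum] at s1
  have s2 := le_sum_mul_quadForm_pow hN h0 hβ q
  have s3 := trace_pow_succ_le hN h0 hle q
  have s4 : β * ((q + 1) / Q) * Real.exp (-L) * (N ^ (q + 1)).trace
      ≤ (q + 1) * Real.exp (-L) * ∑ i, p i * (v i ⬝ᵥ (N ^ q) *ᵥ v i) := by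
    calc β * ((q + 1) / Q) * Real.exp (-L) * (N ^ (q + 1)).trace
        ≤ β * ((q + 1) / Q) * Real.exp (-L) * (Q * (N ^ q).trace) :=
          mul_le_mul_of_nonneg_left s3 (by positivity)
      _ = (q + 1) * Real.exp (-L) * (β * (N ^ q).trace) := by field_simp
      _ ≤ _ := mul_le_mul_of_nonneg_left s2 (by positivity)
  have s5 := mul_le_mul_of_nonneg_right
    (Real.add_one_le_exp (-(β * ((q + 1) / Q) * Real.exp (-L))))
    (trace_pow_nonneg hN h0 (q + 1))
  linarith

theorem sum_fin_succ_pi {M : Type*} [AddCommMonoid M] {t : ℕ} (f : (Fin (t + 1) → κ) → M) :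
    ∑ s, f s = ∑ i, ∑ s : Fin t → κ, f (Fin.cons i s) := by
  rw [← Fintype.sum_prod_type']
  exact (Fintype.sum_equiv (Fin.consEquiv fun _ => κ) _ _ fun _ => rfl).symm

/-- The expectation over `t` independent samples of the trace of a power: each sample contributes
the factor of the one-step bound. -/
theorem sum_prod_mul_trace_pow_add_le (hp : ∀ i, 0 ≤ p i) (hp1 : ∑ i, p i = 1)
    (hL : ∀ i, v i ⬝ᵥ v i ≤ L)
    (hβ : ∀ x, ∑ i, p i * (v i ⬝ᵥ x) ^ 2 ≤ β * (x ⬝ᵥ x)) (hβ0 : 0 ≤ β) {q : ℕ} (t : ℕ)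
    {N : Matrix ι ι ℝ} (hN : Nᵀ = N) (h : FormGE N (q + 1)) :
    ∑ s : Fin t → κ, (∏ j, p (s j)) *
        ((N + ∑ j, Matrix.vecMulVec (v (s j)) (v (s j))) ^ (q + 1)).trace
      ≤ Real.exp (β * Real.exp L) ^ t * (N ^ (q + 1)).trace := by
  induction t generalizing N with
  | zero => simp
  | succ t ih =>
    rw [sum_fin_succ_pi]
    calc _ = ∑ i, p i * ∑ s : Fin t → κ, (∏ j, p (s j)) *
          ((N + Matrix.vecMulVec (v i) (v i)
            + ∑ j, Matrix.vecMulVec (v (s j)) (v (s j))) ^ (q + 1)).trace := by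
          refine Finset.sum_congr rfl fun i _ => ?_
          rw [Finset.mul_sum]
          refine Finset.sum_congr rfl fun s _ => ?_
          simp only [Fin.prod_univ_succ, Fin.sum_univ_succ, Fin.cons_zero, Fin.cons_succ,
            add_assoc, mul_assoc]
      _ ≤ ∑ i, p i * (Real.exp (β * Real.exp L) ^ t *
            ((N + Matrix.vecMulVec (v i) (v i)) ^ (q + 1)).trace) := by
          refine Finset.sum_le_sum fun i _ => mul_le_mul_of_nonneg_left (ih ?_ ?_) (hp i)
          · rw [Matrix.transpose_add, hN, transpose_vecMulVec_self]
          · intro x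
            rw [Matrix.add_mulVec, dotProduct_add, quadForm_vecMulVec]
            linarith [h x, sq_nonneg (v i ⬝ᵥ x)]
      _ = Real.exp (β * Real.exp L) ^ t *
            ∑ i, p i * ((N + Matrix.vecMulVec (v i) (v i)) ^ (q + 1)).trace := by
          rw [Finset.mul_sum]
          exact Finset.sum_congr rfl fun i _ => by ring
      _ ≤ Real.exp (β * Real.exp L) ^ t *
            (Real.exp (β * Real.exp L) * (N ^ (q + 1)).trace) :=
          mul_le_mul_of_nonneg_left (sum_mul_trace_pow_add_le hp hp1 hL hβ hβ0 hN h)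
            (by positivity)
      _ = _ := by ring

/-- The analogue of `sum_prod_mul_trace_pow_add_le` for subtracted samples. The hypothesis
`N ≥ (q + 1 + t L) I` keeps every partial difference above `(q + 1) I`. -/
theorem sum_prod_mul_trace_pow_sub_le (hp : ∀ i, 0 ≤ p i) (hp1 : ∑ i, p i = 1)
    (hL : ∀ i, v i ⬝ᵥ v i ≤ L) (hL0 : 0 ≤ L)
    (hβ : ∀ x, β * (x ⬝ᵥ x) ≤ ∑ i, p i * (v i ⬝ᵥ x) ^ 2) (hβ0 : 0 ≤ β) {q : ℕ} {Q : ℝ}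
    (hQ : 0 < Q) (t : ℕ) {N : Matrix ι ι ℝ} (hN : Nᵀ = N) (h : FormGE N (q + 1 + t * L))
    (hle : FormLE N Q) :
    ∑ s : Fin t → κ, (∏ j, p (s j)) *
        ((N - ∑ j, Matrix.vecMulVec (v (s j)) (v (s j))) ^ (q + 1)).trace
      ≤ Real.exp (-(β * ((q + 1) / Q) * Real.exp (-L))) ^ t * (N ^ (q + 1)).trace := by
  induction t generalizing N with
  | zero => simp
  | succ t ih =>
    set K := Real.exp (-(β * ((q + 1) / Q) * Real.exp (-L))) with hK
    rw [sum_fin_succ_pi]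
    calc _ = ∑ i, p i * ∑ s : Fin t → κ, (∏ j, p (s j)) *
          ((N - Matrix.vecMulVec (v i) (v i)
            - ∑ j, Matrix.vecMulVec (v (s j)) (v (s j))) ^ (q + 1)).trace := by
          refine Finset.sum_congr rfl fun i _ => ?_
          rw [Finset.mul_sum]
          refine Finset.sum_congr rfl fun s _ => ?_
          simp only [Fin.prod_univ_succ, Fin.sum_univ_succ, Fin.cons_zero, Fin.cons_succ,
            sub_sub, mul_assoc]
      _ ≤ ∑ i, p i * (K ^ t *
            ((N - Matrix.vecMulVec (v i) (v i)) ^ (q + 1)).trace) := by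
          refine Finset.sum_le_sum fun i _ => mul_le_mul_of_nonneg_left (ih ?_ ?_ ?_) (hp i)
          · rw [Matrix.transpose_sub, hN, transpose_vecMulVec_self]
          · intro x
            rw [Matrix.sub_mulVec, dotProduct_sub, quadForm_vecMulVec]
            have c1 := sq_dotProduct_le (v i) x
            have c2 := mul_le_mul_of_nonneg_right (hL i) (dotProduct_self_nonneg x)
            have c3 := h x
            push_cast at c3
            linarith
          · intro x
            rw [Matrix.sub_mulVec, dotProduct_sub, quadForm_vecMulVec]
            linarith [hle x, sq_nonneg (v i ⬝ᵥ x)]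
      _ = K ^ t * ∑ i, p i * ((N - Matrix.vecMulVec (v i) (v i)) ^ (q + 1)).trace := by
          rw [Finset.mul_sum]
          exact Finset.sum_congr rfl fun i _ => by ring
      _ ≤ K ^ t * (K * (N ^ (q + 1)).trace) := by
          refine mul_le_mul_of_nonneg_left ?_ (by positivity)
          refine sum_mul_trace_pow_sub_le hp hp1 hL hβ hβ0 hQ hN (h.mono ?_) hL0 hle
          push_cast
          nlinarith [mul_nonneg (Nat.cast_nonneg (α := ℝ) t) hL0]
      _ = _ := by ring

theorem trace_smul_one_pow (c : ℝ) (q : ℕ) :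
    ((c • (1 : Matrix ι ι ℝ)) ^ q).trace = Fintype.card ι * c ^ q := by
  rw [smul_pow, one_pow, Matrix.trace_smul, Matrix.trace_one, smul_eq_mul, mul_comm]

theorem quadForm_smul_one (c : ℝ) (x : ι → ℝ) :
    x ⬝ᵥ (c • (1 : Matrix ι ι ℝ)) *ᵥ x = c * (x ⬝ᵥ x) := by
  rw [Matrix.smul_mulVec, Matrix.one_mulVec, dotProduct_smul, smul_eq_mul]

/-- Markov's inequality for the nonnegative weights `w`. -/
theorem sum_filter_mul_le {σ : Type*} [Fintype σ] {w f : σ → ℝ} (hw : ∀ s, 0 ≤ w s)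
    (hf : ∀ s, 0 ≤ f s) (P : σ → Prop) [DecidablePred P] {a b : ℝ} (hP : ∀ s, P s → a ≤ f s)
    (hb : ∑ s, w s * f s ≤ b) : (∑ s with P s, w s) * a ≤ b := by
  rw [Finset.sum_mul]
  refine le_trans ?_ hb
  calc ∑ s with P s, w s * a ≤ ∑ s with P s, w s * f s :=
        Finset.sum_le_sum fun s hs =>
          mul_le_mul_of_nonneg_left (hP s (Finset.mem_filter.1 hs).2) (hw s)
    _ ≤ _ := Finset.sum_le_sum_of_subset_of_nonneg (Finset.filter_subset _ _)
        fun s _ _ => mul_nonneg (hw s) (hf s)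

open Filter Topology

open Classical in
/-- Upper matrix Chernoff bound. The potential is `tr (I + M / (q + 1)) ^ (q + 1)`, which tends to
`tr exp M` as `q → ∞`. -/
theorem chernoff_upper_aux (hp : ∀ i, 0 ≤ p i) (hp1 : ∑ i, p i = 1)
    (hL : ∀ i, v i ⬝ᵥ v i ≤ L)
    (hβ : ∀ x, ∑ i, p i * (v i ⬝ᵥ x) ^ 2 ≤ β * (x ⬝ᵥ x)) (hβ0 : 0 ≤ β) {b : ℝ} (hb : 0 ≤ b)
    (t : ℕ) :
    ∑ s : Fin t → κ with ¬ ∀ x, ∑ j, (v (s j) ⬝ᵥ x) ^ 2 ≤ b * (x ⬝ᵥ x), ∏ j, p (s j)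
      ≤ Fintype.card ι * Real.exp (t * (β * Real.exp L) - b) := by
  set S := ∑ s : Fin t → κ with ¬ ∀ x, ∑ j, (v (s j) ⬝ᵥ x) ^ 2 ≤ b * (x ⬝ᵥ x), ∏ j, p (s j)
  have main : ∀ q : ℕ, S * (1 + b / ((q + 1 : ℕ) : ℝ)) ^ (q + 1)
      ≤ Fintype.card ι * Real.exp (t * (β * Real.exp L)) := by
    intro q
    have hq : (0 : ℝ) < (q : ℝ) + 1 := by positivity
    have hN : (((q : ℝ) + 1) • (1 : Matrix ι ι ℝ))ᵀ = ((q : ℝ) + 1) • 1 := by simp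
    have hT := fun s : Fin t → κ => transpose_sum_vecMulVec v s
    have hT' : ∀ s : Fin t → κ, (((q : ℝ) + 1) • (1 : Matrix ι ι ℝ)
        + ∑ j, Matrix.vecMulVec (v (s j)) (v (s j)))ᵀ
        = ((q : ℝ) + 1) • (1 : Matrix ι ι ℝ) + ∑ j, Matrix.vecMulVec (v (s j)) (v (s j)) :=
      fun s => by rw [Matrix.transpose_add, hN, hT]
    have h0 : ∀ s : Fin t → κ, FormGE (((q : ℝ) + 1) • (1 : Matrix ι ι ℝ)
        + ∑ j, Matrix.vecMulVec (v (s j)) (v (s j))) 0 := fun s x => by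
      rw [Matrix.add_mulVec, dotProduct_add, quadForm_smul_one, quadForm_sum_vecMulVec, zero_mul]
      have := dotProduct_self_nonneg x
      positivity
    have e := sum_prod_mul_trace_pow_add_le (q := q) hp hp1 hL hβ hβ0 t hN
      (fun x => (quadForm_smul_one _ x).ge)
    have mk := sum_filter_mul_le (fun s => Finset.prod_nonneg fun j _ => hp (s j))
      (fun s => trace_pow_nonneg (hT' s) (h0 s) (q + 1))
      (fun s => ¬ ∀ x, ∑ j, (v (s j) ⬝ᵥ x) ^ 2 ≤ b * (x ⬝ᵥ x))
      (a := ((q : ℝ) + 1 + b) ^ (q + 1)) (fun s hs => by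
        refine pow_le_trace_pow (hT' s) (h0 s) (by positivity) (fun hle => hs fun x => ?_) _
        have := hle x
        rw [Matrix.add_mulVec, dotProduct_add, quadForm_smul_one, quadForm_sum_vecMulVec] at this
        linarith) e
    rw [trace_smul_one_pow, ← Real.exp_nat_mul] at mk
    have e2 : ((q : ℝ) + 1 + b) ^ (q + 1)
        = (1 + b / ((q + 1 : ℕ) : ℝ)) ^ (q + 1) * ((q : ℝ) + 1) ^ (q + 1) := by
      rw [← mul_pow]; congr 1; push_cast; field_simp
    rw [e2] at mk
    refine le_of_mul_le_mul_right ?_ (pow_pos hq (q + 1))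
    calc _ ≤ _ := le_trans (le_of_eq (mul_assoc _ _ _)) mk
      _ = _ := by ring
  have lim := ((Real.tendsto_one_add_div_pow_exp b).comp (tendsto_add_atTop_nat 1)).const_mul S
  have := le_of_tendsto lim (Eventually.of_forall main)
  rw [Real.exp_sub, ← mul_div_assoc, le_div_iff₀ (Real.exp_pos b)]
  exact this

open Classical in
/-- Lower matrix Chernoff bound. The potential is `tr (I - M / Q) ^ (q + 1)` with
`Q = q + 1 + t L`, which tends to `tr exp (-M)` as `q → ∞`. -/
theorem chernoff_lower_aux (hp : ∀ i, 0 ≤ p i) (hp1 : ∑ i, p i = 1)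
    (hL : ∀ i, v i ⬝ᵥ v i ≤ L) (hL0 : 0 ≤ L)
    (hβ : ∀ x, β * (x ⬝ᵥ x) ≤ ∑ i, p i * (v i ⬝ᵥ x) ^ 2) (hβ0 : 0 ≤ β) (b : ℝ) (t : ℕ) :
    ∑ s : Fin t → κ with ¬ ∀ x, b * (x ⬝ᵥ x) ≤ ∑ j, (v (s j) ⬝ᵥ x) ^ 2, ∏ j, p (s j)
      ≤ Fintype.card ι * Real.exp (b - t * (β * Real.exp (-L))) := by
  set S := ∑ s : Fin t → κ with ¬ ∀ x, b * (x ⬝ᵥ x) ≤ ∑ j, (v (s j) ⬝ᵥ x) ^ 2, ∏ j, p (s j)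
  have hr1 : Tendsto (fun q : ℕ => ((q : ℝ) + 1) / (q + 1 + t * L)) atTop (𝓝 1) := by
    have := (tendsto_natCast_div_add_atTop (𝕜 := ℝ) (t * L)).comp (tendsto_add_atTop_nat 1)
    refine this.congr fun q => ?_
    simp
  have hr2 : Tendsto (fun q : ℕ => ((q : ℝ) + 1) / (q + 1 + (t * L - b))) atTop (𝓝 1) := by
    have := (tendsto_natCast_div_add_atTop (𝕜 := ℝ) (t * L - b)).comp (tendsto_add_atTop_nat 1)
    refine this.congr fun q => ?_
    simp
  have main : ∀ q : ℕ, b < q → S ≤ Fintype.card ι * Real.exp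
      (((q : ℝ) + 1) / (q + 1 + (t * L - b)) * b
        - t * (β * (((q : ℝ) + 1) / (q + 1 + t * L)) * Real.exp (-L))) := by
    intro q hbq
    have htL : 0 ≤ t * L := by positivity
    set Q : ℝ := q + 1 + t * L with hQdef
    have hQ : 0 < Q := by positivity
    have hQb : 0 < Q - b := by rw [hQdef]; linarith
    have hN : (Q • (1 : Matrix ι ι ℝ))ᵀ = Q • 1 := by simp
    have hT' : ∀ s : Fin t → κ, (Q • (1 : Matrix ι ι ℝ)
        - ∑ j, Matrix.vecMulVec (v (s j)) (v (s j)))ᵀ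
        = Q • (1 : Matrix ι ι ℝ) - ∑ j, Matrix.vecMulVec (v (s j)) (v (s j)) :=
      fun s => by rw [Matrix.transpose_sub, hN, transpose_sum_vecMulVec]
    have h0 : ∀ s : Fin t → κ, FormGE (Q • (1 : Matrix ι ι ℝ)
        - ∑ j, Matrix.vecMulVec (v (s j)) (v (s j))) 0 := fun s x => by
      rw [Matrix.sub_mulVec, dotProduct_sub, quadForm_smul_one, quadForm_sum_vecMulVec, zero_mul]
      have c : ∑ j, (v (s j) ⬝ᵥ x) ^ 2 ≤ ∑ _j : Fin t, L * (x ⬝ᵥ x) :=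
        Finset.sum_le_sum fun j _ => by
          have c1 := sq_dotProduct_le (v (s j)) x
          exact c1.trans (mul_le_mul_of_nonneg_right (hL _) (dotProduct_self_nonneg x))
      rw [Finset.sum_const, Finset.card_univ, Fintype.card_fin, nsmul_eq_mul] at c
      have : 0 ≤ ((q : ℝ) + 1) * (x ⬝ᵥ x) := mul_nonneg (by positivity) (dotProduct_self_nonneg x)
      rw [hQdef]
      linarith
    have e := sum_prod_mul_trace_pow_sub_le (q := q) hp hp1 hL hL0 hβ hβ0 hQ t hN
      (fun x => (quadForm_smul_one _ x).ge) (fun x => (quadForm_smul_one _ x).le)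
    have mk := sum_filter_mul_le (fun s => Finset.prod_nonneg fun j _ => hp (s j))
      (fun s => trace_pow_nonneg (hT' s) (h0 s) (q + 1))
      (fun s => ¬ ∀ x, b * (x ⬝ᵥ x) ≤ ∑ j, (v (s j) ⬝ᵥ x) ^ 2)
      (a := (Q - b) ^ (q + 1)) (fun s hs => by
        refine pow_le_trace_pow (hT' s) (h0 s) hQb.le (fun hle => hs fun x => ?_) _
        have := hle x
        rw [Matrix.sub_mulVec, dotProduct_sub, quadForm_smul_one, quadForm_sum_vecMulVec] at this
        linarith) e
    rw [trace_smul_one_pow, ← Real.exp_nat_mul] at mk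
    have hS : 0 ≤ S := Finset.sum_nonneg fun s _ => Finset.prod_nonneg fun j _ => hp (s j)
    -- `Q ≤ (Q - b) exp (b / (Q - b))`
    have e2 : Q ^ (q + 1) ≤ (Q - b) ^ (q + 1) * Real.exp (((q : ℝ) + 1) / (Q - b) * b) := by
      have : Q ≤ (Q - b) * Real.exp (b / (Q - b)) := by
        have := mul_le_mul_of_nonneg_left (Real.add_one_le_exp (b / (Q - b))) hQb.le
        refine le_trans (le_of_eq ?_) this
        field_simp
        ring
      calc Q ^ (q + 1) ≤ ((Q - b) * Real.exp (b / (Q - b))) ^ (q + 1) :=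
            pow_le_pow_left₀ hQ.le this _
        _ = _ := by
            rw [mul_pow, ← Real.exp_nat_mul]
            congr 2
            push_cast
            field_simp
    refine le_of_mul_le_mul_right ?_ (pow_pos hQb (q + 1))
    refine mk.trans ?_
    have e3 : (q : ℝ) + 1 + (t * L - b) = Q - b := by rw [hQdef]; ring
    rw [e3, sub_eq_add_neg (_ * b), Real.exp_add, ← mul_neg (t : ℝ)]
    calc _ ≤ Real.exp (t * -(β * ((q + 1) / Q) * Real.exp (-L))) *
          (Fintype.card ι * ((Q - b) ^ (q + 1) * Real.exp (((q : ℝ) + 1) / (Q - b) * b))) := by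
          gcongr
      _ = _ := by ring
  have lim : Tendsto (fun q : ℕ => Fintype.card ι * Real.exp
      (((q : ℝ) + 1) / (q + 1 + (t * L - b)) * b
        - t * (β * (((q : ℝ) + 1) / (q + 1 + t * L)) * Real.exp (-L)))) atTop
      (𝓝 (Fintype.card ι * Real.exp (1 * b - t * (β * 1 * Real.exp (-L))))) :=
    (Real.continuous_exp.tendsto _ |>.comp ((hr2.mul_const b).sub
      (((hr1.const_mul β).mul_const _).const_mul _))).const_mul _
  have := ge_of_tendsto lim
    ((tendsto_natCast_atTop_atTop.eventually_gt_atTop b).mono fun q hq => main q hq)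
  simpa using this

open Classical in
/-- Upper matrix Chernoff bound with the Laplace parameter `θ`: the vectors are rescaled by `√θ`. -/
theorem chernoff_upper (hp : ∀ i, 0 ≤ p i) (hp1 : ∑ i, p i = 1)
    (hL : ∀ i, v i ⬝ᵥ v i ≤ L)
    (hβ : ∀ x, ∑ i, p i * (v i ⬝ᵥ x) ^ 2 ≤ β * (x ⬝ᵥ x)) (hβ0 : 0 ≤ β) {b θ : ℝ} (hb : 0 ≤ b)
    (hθ : 0 < θ) (t : ℕ) :
    ∑ s : Fin t → κ with ¬ ∀ x, ∑ j, (v (s j) ⬝ᵥ x) ^ 2 ≤ b * (x ⬝ᵥ x), ∏ j, p (s j)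
      ≤ Fintype.card ι * Real.exp (θ * (t * β * Real.exp (θ * L) - b)) := by
  have := chernoff_upper_aux (v := fun i => √θ • v i) (L := θ * L) (β := θ * β) (b := θ * b)
    hp hp1 (fun i => by
      rw [smul_dotProduct, dotProduct_smul, smul_eq_mul, smul_eq_mul, ← mul_assoc,
        Real.mul_self_sqrt hθ.le]
      exact mul_le_mul_of_nonneg_left (hL i) hθ.le)
    (fun x => by
      simp only [smul_sqrt_dotProduct_sq hθ.le, mul_left_comm _ θ, ← Finset.mul_sum]
      rw [mul_assoc]
      exact mul_le_mul_of_nonneg_left (hβ x) hθ.le)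
    (by positivity) (by positivity) t
  simp only [smul_sqrt_dotProduct_sq hθ.le, ← Finset.mul_sum, mul_assoc θ b,
    mul_le_mul_iff_right₀ hθ] at this
  refine this.trans (le_of_eq ?_)
  congr 2; ring

open Classical in
/-- Lower matrix Chernoff bound with the Laplace parameter `θ`. -/
theorem chernoff_lower (hp : ∀ i, 0 ≤ p i) (hp1 : ∑ i, p i = 1)
    (hL : ∀ i, v i ⬝ᵥ v i ≤ L) (hL0 : 0 ≤ L)
    (hβ : ∀ x, β * (x ⬝ᵥ x) ≤ ∑ i, p i * (v i ⬝ᵥ x) ^ 2) (hβ0 : 0 ≤ β) (b : ℝ) {θ : ℝ}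
    (hθ : 0 < θ) (t : ℕ) :
    ∑ s : Fin t → κ with ¬ ∀ x, b * (x ⬝ᵥ x) ≤ ∑ j, (v (s j) ⬝ᵥ x) ^ 2, ∏ j, p (s j)
      ≤ Fintype.card ι * Real.exp (θ * (b - t * β * Real.exp (-(θ * L)))) := by
  have := chernoff_lower_aux (v := fun i => √θ • v i) (L := θ * L) (β := θ * β)
    hp hp1 (fun i => by
      rw [smul_dotProduct, dotProduct_smul, smul_eq_mul, smul_eq_mul, ← mul_assoc,
        Real.mul_self_sqrt hθ.le]
      exact mul_le_mul_of_nonneg_left (hL i) hθ.le) (by positivity)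
    (fun x => by
      simp only [smul_sqrt_dotProduct_sq hθ.le, mul_left_comm _ θ, ← Finset.mul_sum]
      rw [mul_assoc]
      exact mul_le_mul_of_nonneg_left (hβ x) hθ.le)
    (by positivity) (θ * b) t
  simp only [smul_sqrt_dotProduct_sq hθ.le, ← Finset.mul_sum, mul_assoc θ b,
    mul_le_mul_iff_right₀ hθ] at this
  refine this.trans (le_of_eq ?_)
  congr 2; ring

end Chernoff

/-! ### Low-rank approximation error and ridge leverage scores -/

theorem frobSq_eq_trace {m n : ℕ} (C : Matrix (Fin m) (Fin n) ℝ) : frobSq C = (C * Cᵀ).trace := by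
  simp [frobSq, Matrix.trace, Matrix.mul_apply, sq]

theorem frobSq_nonneg {m n : ℕ} (C : Matrix (Fin m) (Fin n) ℝ) : 0 ≤ frobSq C :=
  Finset.sum_nonneg fun _ _ => Finset.sum_nonneg fun _ _ => sq_nonneg _

theorem frobSq_mul_mul {m n : ℕ} {W : Matrix (Fin m) (Fin m) ℝ} {U : Matrix (Fin n) (Fin n) ℝ}
    (hW : W * Wᵀ = 1) (hU : U * Uᵀ = 1) (C : Matrix (Fin m) (Fin n) ℝ) :
    frobSq (Wᵀ * C * U) = frobSq C := by
  rw [frobSq_eq_trace, frobSq_eq_trace, Matrix.transpose_mul, Matrix.transpose_mul,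
    Matrix.transpose_transpose]
  calc (Wᵀ * C * U * (Uᵀ * (Cᵀ * W))).trace = (Wᵀ * (C * (U * Uᵀ) * Cᵀ * W)).trace := by
        simp only [Matrix.mul_assoc]
    _ = (C * Cᵀ * (W * Wᵀ)).trace := by
        rw [hU, Matrix.mul_one, Matrix.trace_mul_comm]; simp only [Matrix.mul_assoc]
    _ = _ := by rw [hW, Matrix.mul_one]

theorem lowRankErrSq_nonneg {m n : ℕ} (M : Matrix (Fin m) (Fin n) ℝ) (k : ℕ) :
    0 ≤ lowRankErrSq M k :=
  Real.sInf_nonneg fun _ ⟨_, _, hx⟩ => hx ▸ frobSq_nonneg _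

theorem lowRankErrSq_le {m n : ℕ} {M B : Matrix (Fin m) (Fin n) ℝ} {k : ℕ} (hB : B.rank ≤ k) :
    lowRankErrSq M k ≤ frobSq (M - B) :=
  csInf_le ⟨0, fun _ ⟨_, _, hx⟩ => hx ▸ frobSq_nonneg _⟩ ⟨B, hB, rfl⟩

theorem rank_orthDiag_le {n : ℕ} {N U : Matrix (Fin n) (Fin n) ℝ} {e : Fin n → ℝ}
    (hd : IsOrthDiag N U e) : N.rank ≤ (Finset.univ.filter fun l => e l ≠ 0).card := by
  rw [hd.eq]
  refine (Matrix.rank_mul_le_left _ _).trans ((Matrix.rank_mul_le_right _ _).trans ?_)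
  rw [Matrix.rank_diagonal, Fintype.card_subtype]

theorem card_le_rank_orthDiag {n : ℕ} {N U : Matrix (Fin n) (Fin n) ℝ} {e : Fin n → ℝ}
    (hd : IsOrthDiag N U e) : (Finset.univ.filter fun l => e l ≠ 0).card ≤ N.rank := by
  have : Matrix.diagonal e = Uᵀ * N * U := by
    rw [hd.eq]
    calc Matrix.diagonal e = (Uᵀ * U) * Matrix.diagonal e * (Uᵀ * U) := by
          rw [hd.transpose_mul, Matrix.one_mul, Matrix.mul_one]
      _ = _ := by simp only [Matrix.mul_assoc]
  rw [← Fintype.card_subtype, ← Matrix.rank_diagonal, this]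
  exact (Matrix.rank_mul_le_left _ _).trans (Matrix.rank_mul_le_right _ _)

/-- A rank-`k` matrix `B` captures at most half of all but `2 k` of the eigenvectors of `M`. In an
eigenbasis `W` of `B Bᵀ`, the rows of `Wᵀ B` outside a set `R` of size `rank B` vanish, and the
squared entries of `Wᵀ U` are doubly stochastic weights. -/
theorem exists_heavy_set_of_rank_le {n k : ℕ} {M U B : Matrix (Fin n) (Fin n) ℝ}
    {e : Fin n → ℝ} (hd : IsOrthDiag M U e) (hB : B.rank ≤ k) :
    ∃ J : Finset (Fin n), J.card ≤ 2 * k ∧ ∑ l ∈ Jᶜ, e l ^ 2 ≤ 2 * frobSq (M - B) := by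
  obtain ⟨W, g, hW⟩ := exists_isOrthDiag (N := B * Bᵀ)
    (by rw [Matrix.transpose_mul, Matrix.transpose_transpose])
  set R := Finset.univ.filter fun i => g i ≠ 0 with hR
  have hRk : R.card ≤ k :=
    (card_le_rank_orthDiag hW).trans ((Matrix.rank_mul_le_left _ _).trans hB)
  set D := Wᵀ * U with hD
  have hDD : D * Dᵀ = 1 := by
    rw [hD, Matrix.transpose_mul, Matrix.transpose_transpose]
    calc Wᵀ * U * (Uᵀ * W) = Wᵀ * (U * Uᵀ) * W := by simp only [Matrix.mul_assoc]
      _ = 1 := by rw [hd.mul_transpose, Matrix.mul_one, hW.transpose_mul]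
  have hDD' : Dᵀ * D = 1 := mul_eq_one_comm.mp hDD
  have row : ∀ i, ∑ l, D i l ^ 2 = 1 := fun i => by
    have := congrFun (congrFun hDD i) i
    simpa [Matrix.mul_apply, sq] using this
  have col : ∀ l, ∑ i, D i l ^ 2 = 1 := fun l => by
    have := congrFun (congrFun hDD' l) l
    simpa [Matrix.mul_apply, sq] using this
  have hBW : ∀ i ∉ R, ∀ j, (Wᵀ * B) i j = 0 := by
    intro i hi
    have gi : g i = 0 := by simpa [hR] using hi
    have h1 := hW.quadForm_col i
    rw [gi, ← Matrix.mulVec_mulVec, Matrix.dotProduct_mulVec, ← Matrix.mulVec_transpose,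
      dotProduct_self_eq_zero] at h1
    intro j
    have := congrFun h1 j
    simpa [Matrix.mul_apply, Matrix.mulVec, dotProduct, mul_comm] using this
  have hent : ∀ i ∉ R, ∀ l, (Wᵀ * (M - B) * U) i l = D i l * e l := by
    intro i hi l
    have h1 : Wᵀ * M * U = D * Matrix.diagonal e := by
      rw [hd.eq, hD]
      calc Wᵀ * (U * Matrix.diagonal e * Uᵀ) * U = Wᵀ * U * Matrix.diagonal e * (Uᵀ * U) := by
            simp only [Matrix.mul_assoc]
        _ = _ := by rw [hd.transpose_mul, Matrix.mul_one]
    have h2 : (Wᵀ * B * U) i l = 0 := by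
      rw [Matrix.mul_apply]
      exact Finset.sum_eq_zero fun j _ => by rw [hBW i hi j, zero_mul]
    rw [Matrix.mul_sub, Matrix.sub_mul, Matrix.sub_apply, h2, h1, Matrix.mul_diagonal, sub_zero]
  have lower : ∑ l, e l ^ 2 * ∑ i ∈ Rᶜ, D i l ^ 2 ≤ frobSq (M - B) := by
    rw [← frobSq_mul_mul hW.mul_transpose hd.mul_transpose, frobSq]
    calc ∑ l, e l ^ 2 * ∑ i ∈ Rᶜ, D i l ^ 2
        = ∑ i ∈ Rᶜ, ∑ l, (Wᵀ * (M - B) * U) i l ^ 2 := by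
          simp only [Finset.mul_sum]
          rw [Finset.sum_comm]
          refine Finset.sum_congr rfl fun i hi => Finset.sum_congr rfl fun l _ => ?_
          rw [hent i (Finset.mem_compl.1 hi)]; ring
      _ ≤ _ := Finset.sum_le_sum_of_subset_of_nonneg (Finset.subset_univ _)
          fun i _ _ => Finset.sum_nonneg fun l _ => sq_nonneg _
  have wnn : ∀ l, 0 ≤ ∑ i ∈ R, D i l ^ 2 := fun l => Finset.sum_nonneg fun i _ => sq_nonneg _
  refine ⟨Finset.univ.filter fun l => 1 / 2 < ∑ i ∈ R, D i l ^ 2, ?_, ?_⟩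
  · set J := Finset.univ.filter fun l => 1 / 2 < ∑ i ∈ R, D i l ^ 2
    have h1 : (J.card : ℝ) * (1 / 2) ≤ R.card := by
      calc (J.card : ℝ) * (1 / 2) = ∑ l ∈ J, (1 / 2 : ℝ) := by simp
        _ ≤ ∑ l ∈ J, ∑ i ∈ R, D i l ^ 2 :=
            Finset.sum_le_sum fun l hl => (Finset.mem_filter.1 hl).2.le
        _ ≤ ∑ l, ∑ i ∈ R, D i l ^ 2 :=
            Finset.sum_le_sum_of_subset_of_nonneg (Finset.subset_univ _) fun l _ _ => wnn l
        _ = R.card := by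
            rw [Finset.sum_comm]; simp [row]
    have h2 : (J.card : ℝ) ≤ (2 * R.card : ℕ) := by push_cast; linarith
    have h3 : J.card ≤ 2 * R.card := by exact_mod_cast h2
    omega
  · refine le_trans ?_ (mul_le_mul_of_nonneg_left lower zero_le_two)
    rw [Finset.mul_sum]
    refine le_trans (Finset.sum_le_sum fun l hl => ?_)
      (Finset.sum_le_sum_of_subset_of_nonneg (Finset.subset_univ _) fun l _ _ => ?_)
    · have h1 : ∑ i ∈ R, D i l ^ 2 ≤ 1 / 2 := by simpa using hl
      have h2 := Finset.sum_add_sum_compl R fun i => D i l ^ 2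
      rw [col l] at h2
      nlinarith [sq_nonneg (e l)]
    · exact mul_nonneg zero_le_two (mul_nonneg (sq_nonneg _)
        (Finset.sum_nonneg fun i _ => sq_nonneg _))

/-- A form of the Eckart–Young theorem, up to constants: removing `2 k` eigenvalues leaves at most
twice the optimal rank-`k` error. -/
theorem exists_heavy_set {n : ℕ} {M U : Matrix (Fin n) (Fin n) ℝ} {e : Fin n → ℝ}
    (hd : IsOrthDiag M U e) (k : ℕ) :
    ∃ J : Finset (Fin n), J.card ≤ 2 * k ∧ ∑ l ∈ Jᶜ, e l ^ 2 ≤ 2 * lowRankErrSq M k := by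
  -- a best choice of `J` works for all `B` at once, so that the infimum need not be attained
  obtain ⟨J, hJ, hmin⟩ := Finset.exists_min_image
    (Finset.univ.filter fun J : Finset (Fin n) => J.card ≤ 2 * k)
    (fun J => ∑ l ∈ Jᶜ, e l ^ 2) ⟨∅, by simp⟩
  refine ⟨J, (Finset.mem_filter.1 hJ).2, ?_⟩
  have : (∑ l ∈ Jᶜ, e l ^ 2) / 2 ≤ lowRankErrSq M k := by
    refine le_csInf ⟨_, 0, by simp, rfl⟩ ?_
    rintro _ ⟨B, hB, rfl⟩
    obtain ⟨J', hJ', hle⟩ := exists_heavy_set_of_rank_le hd hB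
    have := hmin J' (by simpa using hJ')
    linarith
  linarith

theorem lowRankErrSq_le_sum_compl {n k : ℕ} {M U : Matrix (Fin n) (Fin n) ℝ} {e : Fin n → ℝ}
    (hd : IsOrthDiag M U e) {J : Finset (Fin n)} (hJ : J.card ≤ k) :
    lowRankErrSq M k ≤ ∑ l ∈ Jᶜ, e l ^ 2 := by
  have hB := hd.map fun l => if l ∈ J then e l else 0
  refine (lowRankErrSq_le (B := U * Matrix.diagonal (fun l => if l ∈ J then e l else 0) * Uᵀ)
    ((rank_orthDiag_le hB).trans ((Finset.card_le_card fun l hl => ?_).trans hJ))).trans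
    (le_of_eq ?_)
  · by_contra h
    simp [h] at hl
  · have h1 : M - U * Matrix.diagonal (fun l => if l ∈ J then e l else 0) * Uᵀ
        = U * Matrix.diagonal (fun l => if l ∈ J then 0 else e l) * Uᵀ := by
      rw [hd.eq, ← Matrix.sub_mul, ← Matrix.mul_sub, Matrix.diagonal_sub]
      congr 3
      funext l
      split_ifs <;> simp
    have h2 := hd.map fun l => if l ∈ J then 0 else e l
    rw [h1, frobSq_eq_trace, h2.transpose_eq, (h2.mul h2).trace,
      ← Finset.sum_add_sum_compl J]
    rw [Finset.sum_eq_zero fun l hl => by simp [hl], zero_add]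
    refine Finset.sum_congr rfl fun l hl => ?_
    rw [if_neg (Finset.mem_compl.1 hl), sq]

section RidgeScore

variable {n : ℕ} {A U : Matrix (Fin n) (Fin n) ℝ} {a : Fin n → ℝ}

open scoped MatrixOrder in
theorem psdSqrt_isOrthDiag (hd : IsOrthDiag A U a) (ha : ∀ l, 0 ≤ a l) :
    IsOrthDiag (psdSqrt A) U fun l => √(a l) := by
  have h := hd.map fun l => √(a l)
  have e1 : psdSqrt A = U * Matrix.diagonal (fun l => √(a l)) * Uᵀ := by
    refine CFC.sqrt_unique ?_ ?_
    · rw [(h.mul h).eq, hd.eq]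
      simp only [Real.mul_self_sqrt (ha _)]
    · rw [Matrix.nonneg_iff_posSemidef]
      have := (Matrix.PosSemidef.diagonal (d := fun l => √(a l))
        (fun l => Real.sqrt_nonneg _)).mul_mul_conjTranspose_same U
      rwa [Matrix.conjTranspose_eq_transpose_of_trivial] at this
  rw [e1]
  exact h

theorem pinv_isOrthDiag {N : Matrix (Fin n) (Fin n) ℝ} {e : Fin n → ℝ} (hd : IsOrthDiag N U e) :
    IsOrthDiag (pinv N) U fun l => (e l)⁻¹ := by
  have h := hd.map fun l => (e l)⁻¹
  have e1 : pinv N = U * Matrix.diagonal (fun l => (e l)⁻¹) * Uᵀ := by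
    refine (pinv_spec N).unique ⟨?_, ?_, (hd.mul h).transpose_eq, (h.mul hd).transpose_eq⟩
    · rw [((hd.mul h).mul hd).eq]
      simp only [mul_inv_mul_cancel, ← hd.eq]
    · rw [((h.mul hd).mul h).eq]
      congr 3
      funext l
      have := mul_inv_mul_cancel (e l)⁻¹
      rwa [inv_inv] at this
  rw [e1]
  exact h

/-- The ridge parameter `‖A^{1/2} - (A^{1/2})_k‖_F² / k`. -/
noncomputable def ridgeParam (A : Matrix (Fin n) (Fin n) ℝ) (k : ℕ) : ℝ :=
  lowRankErrSq (psdSqrt A) k / k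

theorem ridgeParam_nonneg (A : Matrix (Fin n) (Fin n) ℝ) (k : ℕ) : 0 ≤ ridgeParam A k :=
  div_nonneg (lowRankErrSq_nonneg _ _) (Nat.cast_nonneg _)

/-- Where `a l = ridgeParam A k = 0` the junk value of the division is the right one. -/
theorem ridgeScore_eq (hd : IsOrthDiag A U a) (ha : ∀ l, 0 ≤ a l) (k : ℕ) (i : Fin n) :
    ridgeScore (psdSqrt A) k i = ∑ l, a l / (a l + ridgeParam A k) * U i l ^ 2 := by
  have hs := psdSqrt_isOrthDiag hd ha
  have hG : IsOrthDiag (psdSqrt A * (psdSqrt A)ᵀ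
      + (lowRankErrSq (psdSqrt A) k / k) • (1 : Matrix (Fin n) (Fin n) ℝ)) U
      (fun l => a l + ridgeParam A k) := by
    refine ⟨hd.transpose_mul, ?_⟩
    rw [hs.transpose_eq, (hs.mul hs).eq]
    have h1 : ridgeParam A k • (1 : Matrix (Fin n) (Fin n) ℝ)
        = U * Matrix.diagonal (fun _ => ridgeParam A k) * Uᵀ := by
      rw [← Matrix.smul_one_eq_diagonal, Matrix.mul_smul, Matrix.smul_mul, Matrix.mul_one,
        hd.mul_transpose]
    change _ + ridgeParam A k • (1 : Matrix (Fin n) (Fin n) ℝ) = _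
    rw [h1, ← Matrix.add_mul, ← Matrix.mul_add, Matrix.diagonal_add]
    simp only [Real.mul_self_sqrt (ha _)]
  have hP := (hs.mul (pinv_isOrthDiag hG)).mul hs
  have e1 : ridgeScore (psdSqrt A) k i
      = (psdSqrt A * pinv (psdSqrt A * (psdSqrt A)ᵀ
          + (lowRankErrSq (psdSqrt A) k / k) • (1 : Matrix (Fin n) (Fin n) ℝ)) * psdSqrt A) i i := by
    rw [ridgeScore, Matrix.mul_assoc, Matrix.mul_apply, dotProduct]
    refine Finset.sum_congr rfl fun j _ => ?_
    have : (psdSqrt A).col i j = psdSqrt A i j := by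
      conv_rhs => rw [← hs.transpose_eq]
      rfl
    rw [this]; rfl
  rw [e1, hP.eq, Matrix.mul_apply]
  refine Finset.sum_congr rfl fun l _ => ?_
  rw [Matrix.mul_diagonal, Matrix.transpose_apply, mul_right_comm (√(a l)),
    Real.mul_self_sqrt (ha l)]
  ring

theorem ridgeScore_nonneg (hd : IsOrthDiag A U a) (ha : ∀ l, 0 ≤ a l) (k : ℕ) (i : Fin n) :
    0 ≤ ridgeScore (psdSqrt A) k i := by
  rw [ridgeScore_eq hd ha]
  exact Finset.sum_nonneg fun l _ => mul_nonneg
    (div_nonneg (ha l) (add_nonneg (ha l) (ridgeParam_nonneg A k))) (sq_nonneg _)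

theorem sum_ridgeScore_le (hd : IsOrthDiag A U a) (ha : ∀ l, 0 ≤ a l) {k : ℕ} (hk : 0 < k) :
    ∑ i, ridgeScore (psdSqrt A) k i ≤ 4 * k := by
  have hk' : (0 : ℝ) < k := by exact_mod_cast hk
  set r := ridgeParam A k with hr
  have hr0 : 0 ≤ r := ridgeParam_nonneg A k
  have e1 : ∑ i, ridgeScore (psdSqrt A) k i = ∑ l, a l / (a l + r) := by
    simp only [ridgeScore_eq hd ha]
    rw [Finset.sum_comm]
    refine Finset.sum_congr rfl fun l _ => ?_
    rw [← Finset.mul_sum]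
    have := hd.transpose_apply_sum l l
    simp only [if_true, ← sq] at this
    rw [this, mul_one]
  obtain ⟨J, hJ, hle⟩ := exists_heavy_set (psdSqrt_isOrthDiag hd ha) k
  simp only [Real.sq_sqrt (ha _)] at hle
  have hE : lowRankErrSq (psdSqrt A) k = k * r := by
    rw [hr, ridgeParam, mul_div_cancel₀ _ hk'.ne']
  rw [hE] at hle
  have b1 : ∑ l ∈ J, a l / (a l + r) ≤ 2 * k := by
    calc ∑ l ∈ J, a l / (a l + r) ≤ ∑ _l ∈ J, (1 : ℝ) :=
          Finset.sum_le_sum fun l _ =>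
            div_le_one_of_le₀ (by linarith) (add_nonneg (ha l) hr0)
      _ = J.card := by simp
      _ ≤ 2 * k := by exact_mod_cast hJ
  have b2 : ∑ l ∈ Jᶜ, a l / (a l + r) ≤ 2 * k := by
    rcases hr0.eq_or_lt with h0 | h0
    · rw [← h0, mul_zero, mul_zero] at hle
      have hz : ∀ l ∈ Jᶜ, a l = 0 :=
        (Finset.sum_eq_zero_iff_of_nonneg fun l _ => ha l).1
          (le_antisymm hle (Finset.sum_nonneg fun l _ => ha l))
      rw [Finset.sum_eq_zero fun l hl => by rw [hz l hl, zero_div]]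
      positivity
    · calc ∑ l ∈ Jᶜ, a l / (a l + r) ≤ ∑ l ∈ Jᶜ, a l / r :=
            Finset.sum_le_sum fun l _ =>
              div_le_div_of_nonneg_left (ha l) h0 (by linarith [ha l])
        _ = (∑ l ∈ Jᶜ, a l) / r := by rw [Finset.sum_div]
        _ ≤ 2 * k := by rw [div_le_iff₀ h0]; linarith
  rw [e1, ← Finset.sum_add_sum_compl J]
  linarith

/-- The ridge parameter of `A^{1/2}` for a rank `k' ≥ 2 k` is controlled by the rank-`k` error of
`A`, through Cauchy–Schwarz on the tail of the spectrum. -/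
theorem mul_ridgeParam_le (hd : IsOrthDiag A U a) (ha : ∀ l, 0 ≤ a l) {k k' : ℕ}
    (hk : 2 * k ≤ k') (hk' : 0 < k') :
    k' * ridgeParam A k' ≤ √(2 * n * lowRankErrSq A k) := by
  have hk0 : (0 : ℝ) < k' := by exact_mod_cast hk'
  obtain ⟨J, hJ, hle⟩ := exists_heavy_set hd k
  have h1 := lowRankErrSq_le_sum_compl (psdSqrt_isOrthDiag hd ha) (hJ.trans hk)
  simp only [Real.sq_sqrt (ha _)] at h1
  rw [ridgeParam, mul_div_cancel₀ _ hk0.ne']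
  refine h1.trans (Real.le_sqrt_of_sq_le ?_)
  have hcard : ((Jᶜ).card : ℝ) ≤ n := by
    exact_mod_cast (Finset.card_le_univ _).trans (Fintype.card_fin n).le
  calc (∑ l ∈ Jᶜ, a l) ^ 2 ≤ (Jᶜ).card * ∑ l ∈ Jᶜ, a l ^ 2 := sq_sum_le_card_mul_sum_sq
    _ ≤ n * (2 * lowRankErrSq A k) := by
        exact mul_le_mul hcard hle (Finset.sum_nonneg fun l _ => sq_nonneg _) (Nat.cast_nonneg _)
    _ = _ := by ring

end RidgeScore

/-! ### Spectral norms and projection-cost preservation -/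

theorem norm_toEuclideanLin_sq {m n : ℕ} (M : Matrix (Fin m) (Fin n) ℝ)
    (x : EuclideanSpace ℝ (Fin n)) :
    ‖Matrix.toEuclideanLin M x‖ ^ 2 = (M *ᵥ x.ofLp) ⬝ᵥ (M *ᵥ x.ofLp) := by
  rw [EuclideanSpace.real_norm_sq_eq]
  simp [dotProduct, sq, Matrix.toLpLin_apply]

theorem norm_toLp_sq {n : ℕ} (x : Fin n → ℝ) : ‖WithLp.toLp 2 x‖ ^ 2 = x ⬝ᵥ x := by
  rw [EuclideanSpace.real_norm_sq_eq]
  simp [dotProduct, sq]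

theorem dotProduct_mulVec_self_le_specNorm {m n : ℕ} (M : Matrix (Fin m) (Fin n) ℝ)
    (x : Fin n → ℝ) : (M *ᵥ x) ⬝ᵥ (M *ᵥ x) ≤ specNorm M ^ 2 * (x ⬝ᵥ x) := by
  have h := (LinearMap.toContinuousLinearMap (Matrix.toEuclideanLin M)).le_opNorm (WithLp.toLp 2 x)
  have h2 := pow_le_pow_left₀ (norm_nonneg _) h 2
  rw [mul_pow, norm_toLp_sq x] at h2
  have h3 := norm_toEuclideanLin_sq M (WithLp.toLp 2 x)
  exact h3 ▸ h2

theorem specNorm_sq_le {m n : ℕ} {M : Matrix (Fin m) (Fin n) ℝ} {r : ℝ} (hr : 0 ≤ r)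
    (h : ∀ x, (M *ᵥ x) ⬝ᵥ (M *ᵥ x) ≤ r * (x ⬝ᵥ x)) : specNorm M ^ 2 ≤ r := by
  have : specNorm M ≤ √r := by
    refine ContinuousLinearMap.opNorm_le_bound _ (Real.sqrt_nonneg r) fun x => ?_
    refine le_of_sq_le_sq ?_ (by positivity)
    rw [mul_pow, Real.sq_sqrt hr]
    have h1 := norm_toEuclideanLin_sq M x
    have h2 := norm_toLp_sq x.ofLp
    calc ‖Matrix.toEuclideanLin M x‖ ^ 2 = _ := h1
      _ ≤ r * (x.ofLp ⬝ᵥ x.ofLp) := h _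
      _ = r * ‖x‖ ^ 2 := by rw [← h2]
  calc specNorm M ^ 2 ≤ √r ^ 2 := pow_le_pow_left₀ (norm_nonneg _) this 2
    _ = r := Real.sq_sqrt hr

/-- A quadratic form inequality for all vectors passes to spectral norms after composition with
any orthogonal projection. -/
theorem mul_specNorm_sq_le {m m' t : ℕ} {B : Matrix (Fin m) (Fin t) ℝ}
    {C : Matrix (Fin m') (Fin t) ℝ} {α β γ : ℝ} (hα : 0 ≤ α) (hβ : 0 ≤ β) (hγ : 0 < γ)
    (h : ∀ x, γ * ((B *ᵥ x) ⬝ᵥ (B *ᵥ x)) ≤ α * ((C *ᵥ x) ⬝ᵥ (C *ᵥ x)) + β * (x ⬝ᵥ x))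
    {P : Matrix (Fin t) (Fin t) ℝ} (hP : IsStarProjection P) :
    γ * specNorm (B * (1 - P)) ^ 2 ≤ α * specNorm (C * (1 - P)) ^ 2 + β := by
  have hPt : Pᵀ = P := by
    have : Pᴴ = P := hP.isSelfAdjoint
    rwa [Matrix.conjTranspose_eq_transpose_of_trivial] at this
  have hPP : P * P = P := hP.isIdempotentElem
  have contr : ∀ x, ((1 - P) *ᵥ x) ⬝ᵥ ((1 - P) *ᵥ x) ≤ x ⬝ᵥ x := fun x => by
    have e1 : (P *ᵥ x) ⬝ᵥ (P *ᵥ x) = x ⬝ᵥ P *ᵥ x := by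
      nth_rewrite 1 [← hPt]
      rw [Matrix.mulVec_transpose, ← Matrix.dotProduct_mulVec, Matrix.mulVec_mulVec, hPP]
    rw [Matrix.sub_mulVec, Matrix.one_mulVec, sub_dotProduct, dotProduct_sub, dotProduct_sub, e1,
      dotProduct_comm (P *ᵥ x) x]
    have := dotProduct_self_nonneg (P *ᵥ x)
    rw [e1] at this
    linarith
  have hr : 0 ≤ α * specNorm (C * (1 - P)) ^ 2 + β := by positivity
  rw [mul_comm γ, ← le_div_iff₀ hγ]
  refine specNorm_sq_le (by positivity) fun x => ?_
  have h1 := h ((1 - P) *ᵥ x)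
  rw [Matrix.mulVec_mulVec, Matrix.mulVec_mulVec] at h1
  have h2 := mul_le_mul_of_nonneg_left (dotProduct_mulVec_self_le_specNorm (C * (1 - P)) x) hα
  have h3 := mul_le_mul_of_nonneg_left (contr x) hβ
  rw [div_mul_eq_mul_div, le_div_iff₀ hγ]
  linarith

theorem isSpectralPCP_of_forall {m n t : ℕ} {ε F κ : ℝ} {k : ℕ} {C : Matrix (Fin n) (Fin t) ℝ}
    {B : Matrix (Fin m) (Fin t) ℝ} (hε : 0 < ε) (hε1 : ε < 1) (hκ0 : 0 ≤ κ) (hκ : κ ≤ ε / k * F)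
    (h1 : ∀ x, (1 - ε) * ((C *ᵥ x) ⬝ᵥ (C *ᵥ x)) ≤ (B *ᵥ x) ⬝ᵥ (B *ᵥ x) + κ * (x ⬝ᵥ x))
    (h2 : ∀ x, (B *ᵥ x) ⬝ᵥ (B *ᵥ x) ≤ (1 + ε) * ((C *ᵥ x) ⬝ᵥ (C *ᵥ x)) + κ * (x ⬝ᵥ x)) :
    IsSpectralPCP ε k F C B := by
  intro P hP
  have e1 := mul_specNorm_sq_le zero_le_one hκ0 (sub_pos.2 hε1)
    (fun x => by rw [one_mul]; exact h1 x) hP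
  have e2 := mul_specNorm_sq_le (by linarith : 0 ≤ 1 + ε) hκ0 zero_lt_one
    (fun x => by rw [one_mul]; exact h2 x) hP
  constructor <;> linarith

/-! ### The deterministic part: spectral splitting at a threshold -/

section Splitting

variable {n t : ℕ} {A U : Matrix (Fin n) (Fin n) ℝ} {a : Fin n → ℝ}

/-- The eigenvalues of the square root of the part of `A` below the threshold `h`. -/
noncomputable def lowSqrt (a : Fin n → ℝ) (h : ℝ) (l : Fin n) : ℝ := if a l ≤ h then √(a l) else 0

/-- `S` is a `δ`-embedding of the span of the eigenvectors of `A` with eigenvalue above `h`. -/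
def PreservesHigh (U : Matrix (Fin n) (Fin n) ℝ) (a : Fin n → ℝ) (h δ : ℝ)
    (S : Matrix (Fin n) (Fin t) ℝ) : Prop :=
  ∀ y : Fin n → ℝ, (∀ l, a l ≤ h → y l = 0) →
    (1 - δ) * (y ⬝ᵥ y) ≤ (Sᵀ *ᵥ (U *ᵥ y)) ⬝ᵥ (Sᵀ *ᵥ (U *ᵥ y)) ∧
    (Sᵀ *ᵥ (U *ᵥ y)) ⬝ᵥ (Sᵀ *ᵥ (U *ᵥ y)) ≤ (1 + δ) * (y ⬝ᵥ y)

/-- `‖Sᵀ A_L^{1/2}‖² ≤ 4 h`, where `A_L` is the part of `A` with eigenvalues at most `h`. -/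
def BoundsLow (U : Matrix (Fin n) (Fin n) ℝ) (a : Fin n → ℝ) (h : ℝ)
    (S : Matrix (Fin n) (Fin t) ℝ) : Prop :=
  ∀ x : Fin n → ℝ, (Sᵀ *ᵥ (U *ᵥ fun l => lowSqrt a h l * x l)) ⬝ᵥ
    (Sᵀ *ᵥ (U *ᵥ fun l => lowSqrt a h l * x l)) ≤ 4 * h * (x ⬝ᵥ x)

theorem dotProduct_mulVec_orth (hd : IsOrthDiag A U a) (y z : Fin n → ℝ) :
    (U *ᵥ y) ⬝ᵥ (U *ᵥ z) = y ⬝ᵥ z := by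
  rw [Matrix.dotProduct_mulVec, ← Matrix.mulVec_transpose, Matrix.mulVec_mulVec,
    hd.transpose_mul, Matrix.one_mulVec]

theorem lowSqrt_sq_le {h : ℝ} (ha : ∀ l, 0 ≤ a l) (hh : 0 ≤ h) (l : Fin n) :
    lowSqrt a h l ^ 2 ≤ h := by
  unfold lowSqrt
  split_ifs with hl
  · rwa [Real.sq_sqrt (ha l)]
  · simpa using hh

/-- The transposed form of `BoundsLow`: `‖A_L^{1/2} S x‖² ≤ 4 h ‖x‖²`. -/
theorem BoundsLow.transpose {h : ℝ} {S : Matrix (Fin n) (Fin t) ℝ} (hS : BoundsLow U a h S)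
    (hh : 0 ≤ h) (x : Fin t → ℝ) :
    (fun l => lowSqrt a h l * (Uᵀ *ᵥ (S *ᵥ x)) l) ⬝ᵥ
      (fun l => lowSqrt a h l * (Uᵀ *ᵥ (S *ᵥ x)) l) ≤ 4 * h * (x ⬝ᵥ x) := by
  set ξ : Fin n → ℝ := fun l => lowSqrt a h l * (Uᵀ *ᵥ (S *ᵥ x)) l with hξ
  have e1 : ξ ⬝ᵥ ξ = (Sᵀ *ᵥ (U *ᵥ fun l => lowSqrt a h l * ξ l)) ⬝ᵥ x := by
    have : ξ ⬝ᵥ ξ = (fun l => lowSqrt a h l * ξ l) ⬝ᵥ (Uᵀ *ᵥ (S *ᵥ x)) :=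
      Finset.sum_congr rfl fun l _ => by simp only [hξ]; ring
    rw [this, Matrix.mulVec_transpose, dotProduct_comm, ← Matrix.dotProduct_mulVec,
      dotProduct_comm, Matrix.mulVec_transpose S, ← Matrix.dotProduct_mulVec]
  have e2 := sq_dotProduct_le (Sᵀ *ᵥ (U *ᵥ fun l => lowSqrt a h l * ξ l)) x
  rw [← e1] at e2
  have e3 := mul_le_mul_of_nonneg_right (hS ξ) (dotProduct_self_nonneg x)
  rcases (dotProduct_self_nonneg ξ).eq_or_lt with h0 | h0
  · rw [← h0]
    have := dotProduct_self_nonneg x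
    positivity
  · refine le_of_mul_le_mul_right ?_ h0
    calc (ξ ⬝ᵥ ξ) * (ξ ⬝ᵥ ξ) = (ξ ⬝ᵥ ξ) ^ 2 := (sq _).symm
      _ ≤ _ := e2.trans e3
      _ = _ := by ring

/-- The scalar inequality behind the splitting: `T = Hs + Ls` is the cost before sampling, `Ps`,
`Qs`, `2 R` are the contributions of the high part, the low part and the cross term after
sampling with `S₂`. -/
theorem splitting_arith {ε Hs Ls Ps Qs R K : ℝ} (hε : 0 < ε) (hε1 : ε < 1)
    (hH : 0 ≤ Hs) (hL : 0 ≤ Ls) (hK : 0 ≤ K) (hLK : Ls ≤ K) (hQK : Qs ≤ K)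
    (hP1 : (1 - ε / 4) * Hs ≤ Ps) (hP2 : Ps ≤ (1 + ε / 4) * Hs) (hQ : 0 ≤ Qs)
    (hR1 : 2 * R ≤ ε / 4 * Ps + 4 / ε * Qs) (hR2 : -(2 * R) ≤ ε / 4 * Ps + 4 / ε * Qs) :
    (1 - ε) * (Hs + Ls) ≤ Ps + 2 * R + Qs + 5 / ε * K ∧
      Ps + 2 * R + Qs ≤ (1 + ε) * (Hs + Ls) + 5 / ε * K := by
  have hq : 4 / ε * Qs ≤ 4 / ε * K := mul_le_mul_of_nonneg_left hQK (by positivity)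
  have hk : K ≤ 1 / ε * K := le_mul_of_one_le_left hK ((one_le_div hε).2 hε1.le)
  have h5 : 5 / ε * K = 4 / ε * K + 1 / ε * K := by ring
  have a1 : (1 - ε / 4) * ((1 - ε / 4) * Hs) ≤ (1 - ε / 4) * Ps :=
    mul_le_mul_of_nonneg_left hP1 (by linarith)
  have a2 : (1 + ε / 4) * Ps ≤ (1 + ε / 4) * ((1 + ε / 4) * Hs) :=
    mul_le_mul_of_nonneg_left hP2 (by linarith)
  have a3 : 0 ≤ ε * Hs := by positivity
  have a4 : ε * (ε * Hs) ≤ 1 * (ε * Hs) := mul_le_mul_of_nonneg_right hε1.le a3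
  have a5 : 0 ≤ ε * Ls := by positivity
  have a6 : 0 ≤ ε * (ε * Hs) := by positivity
  constructor <;> nlinarith

theorem sketch_bounds (hd : IsOrthDiag A U a) (ha : ∀ l, 0 ≤ a l) {h ε : ℝ} (hh : 0 ≤ h)
    (hε : 0 < ε) (hε1 : ε < 1) {S₁ S₂ : Matrix (Fin n) (Fin t) ℝ}
    (hH : PreservesHigh U a h (ε / 4) S₂) (hL₁ : BoundsLow U a h S₁) (hL₂ : BoundsLow U a h S₂)
    (x : Fin t → ℝ) :
    (1 - ε) * (((A * S₁) *ᵥ x) ⬝ᵥ ((A * S₁) *ᵥ x))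
        ≤ ((S₂ᵀ * A * S₁) *ᵥ x) ⬝ᵥ ((S₂ᵀ * A * S₁) *ᵥ x) + 80 * h ^ 2 / ε * (x ⬝ᵥ x) ∧
    ((S₂ᵀ * A * S₁) *ᵥ x) ⬝ᵥ ((S₂ᵀ * A * S₁) *ᵥ x)
        ≤ (1 + ε) * (((A * S₁) *ᵥ x) ⬝ᵥ ((A * S₁) *ᵥ x)) + 80 * h ^ 2 / ε * (x ⬝ᵥ x) := by
  set α := Uᵀ *ᵥ (S₁ *ᵥ x) with hα
  set yH : Fin n → ℝ := fun l => if a l ≤ h then 0 else a l * α l with hyH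
  set ξ : Fin n → ℝ := fun l => lowSqrt a h l * α l with hξ
  set yL : Fin n → ℝ := fun l => lowSqrt a h l * ξ l with hyL
  have hsplit : (fun l => a l * α l) = yH + yL := by
    funext l
    simp only [hyH, hyL, hξ, lowSqrt, Pi.add_apply]
    split_ifs with hl
    · rw [← mul_assoc, Real.mul_self_sqrt (ha l), zero_add]
    · simp
  have horth : yH ⬝ᵥ yL = 0 := Finset.sum_eq_zero fun l _ => by
    simp only [hyH, hyL, lowSqrt]
    split_ifs <;> simp
  have e1 : (A * S₁) *ᵥ x = U *ᵥ yH + U *ᵥ yL := by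
    rw [← Matrix.mulVec_add, ← hsplit, ← Matrix.mulVec_mulVec, hd.eq, ← Matrix.mulVec_mulVec,
      ← Matrix.mulVec_mulVec, ← hα]
    congr 1
    funext l
    rw [Matrix.mulVec_diagonal]
  have e2 : (S₂ᵀ * A * S₁) *ᵥ x = S₂ᵀ *ᵥ (U *ᵥ yH) + S₂ᵀ *ᵥ (U *ᵥ yL) := by
    rw [Matrix.mul_assoc, ← Matrix.mulVec_mulVec, e1, Matrix.mulVec_add]
  set P := S₂ᵀ *ᵥ (U *ᵥ yH) with hP
  set Q := S₂ᵀ *ᵥ (U *ᵥ yL) with hQ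
  have hx := dotProduct_self_nonneg x
  have hξ2 : ξ ⬝ᵥ ξ ≤ 4 * h * (x ⬝ᵥ x) := hL₁.transpose hh x
  have hQ2 : Q ⬝ᵥ Q ≤ 16 * h ^ 2 * (x ⬝ᵥ x) := by
    calc Q ⬝ᵥ Q ≤ 4 * h * (ξ ⬝ᵥ ξ) := hL₂ ξ
      _ ≤ 4 * h * (4 * h * (x ⬝ᵥ x)) := mul_le_mul_of_nonneg_left hξ2 (by positivity)
      _ = _ := by ring
  have hyL2 : yL ⬝ᵥ yL ≤ 16 * h ^ 2 * (x ⬝ᵥ x) := by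
    calc yL ⬝ᵥ yL = ∑ l, lowSqrt a h l ^ 2 * (ξ l * ξ l) :=
          Finset.sum_congr rfl fun l _ => by simp only [hyL]; ring
      _ ≤ ∑ l, h * (ξ l * ξ l) := Finset.sum_le_sum fun l _ =>
          mul_le_mul_of_nonneg_right (lowSqrt_sq_le ha hh l) (mul_self_nonneg _)
      _ = h * (ξ ⬝ᵥ ξ) := by rw [← Finset.mul_sum]; rfl
      _ ≤ h * (4 * h * (x ⬝ᵥ x)) := mul_le_mul_of_nonneg_left hξ2 hh
      _ ≤ _ := by nlinarith [mul_nonneg (sq_nonneg h) hx]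
  obtain ⟨hP1, hP2⟩ := hH yH fun l hl => by simp only [hyH, if_pos hl]
  -- the cross term, by the inequality of arithmetic and geometric means
  have am : ∀ σ : ℝ, σ ^ 2 = 1 → -(σ * (2 * (P ⬝ᵥ Q))) ≤ ε / 4 * (P ⬝ᵥ P) + 4 / ε * (Q ⬝ᵥ Q) := by
    intro σ hσ
    have := dotProduct_self_nonneg ((ε / 4) • P + σ • Q)
    simp only [add_dotProduct, dotProduct_add, smul_dotProduct, dotProduct_smul, smul_eq_mul,
      dotProduct_comm Q P] at this
    refine le_of_mul_le_mul_left ?_ (by positivity : 0 < ε / 4)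
    have e : ε / 4 * (ε / 4 * (P ⬝ᵥ P) + 4 / ε * (Q ⬝ᵥ Q))
        = ε / 4 * (ε / 4 * (P ⬝ᵥ P)) + σ ^ 2 * (Q ⬝ᵥ Q) := by
      rw [hσ]; field_simp
    rw [e]
    linarith
  have key := splitting_arith (R := P ⬝ᵥ Q) hε hε1 (dotProduct_self_nonneg yH)
    (dotProduct_self_nonneg yL) (by positivity) hyL2 hQ2 hP1 hP2 (dotProduct_self_nonneg Q)
    (by have := am (-1) (by norm_num); linarith) (by have := am 1 (by norm_num); linarith)
  have t1 : ((A * S₁) *ᵥ x) ⬝ᵥ ((A * S₁) *ᵥ x) = yH ⬝ᵥ yH + yL ⬝ᵥ yL := by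
    rw [e1, ← Matrix.mulVec_add, dotProduct_mulVec_orth hd, add_dotProduct, dotProduct_add,
      dotProduct_add, dotProduct_comm yL yH, horth]
    ring
  have t2 : ((S₂ᵀ * A * S₁) *ᵥ x) ⬝ᵥ ((S₂ᵀ * A * S₁) *ᵥ x)
      = P ⬝ᵥ P + 2 * (P ⬝ᵥ Q) + Q ⬝ᵥ Q := by
    rw [e2, add_dotProduct, dotProduct_add, dotProduct_add, dotProduct_comm Q P]
    ring
  have t3 : 5 / ε * (16 * h ^ 2 * (x ⬝ᵥ x)) = 80 * h ^ 2 / ε * (x ⬝ᵥ x) := by ring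
  rw [t3] at key
  rw [t1, t2]
  exact key

end Splitting

/-! ### Tail bounds for the sampling matrices -/

section Sampling

open Classical in
/-- The probability of an event about the sampled indices, as a finite sum. -/
theorem IsIIDSample.measureReal_le {Ω : Type*} [MeasurableSpace Ω] {μ : Measure Ω}
    [IsProbabilityMeasure μ] {n t : ℕ} {p : Fin n → ℝ} {X : Fin t → Ω → Fin n}
    (hX : IsIIDSample μ p X) (B : (Fin t → Fin n) → Prop) :
    μ.real {ω | B fun j => X j ω} ≤ ∑ s with B s, ∏ j, p (s j) := by
  have hs : ∀ s : Fin t → Fin n, μ.real {ω | (fun j => X j ω) = s} = ∏ j, p (s j) := by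
    intro s
    have e : {ω | (fun j => X j ω) = s} = ⋂ j ∈ Finset.univ, X j ⁻¹' {s j} := by
      ext ω; simp [funext_iff]
    rw [e, measureReal_def, hX.indep.measure_inter_preimage_eq_mul Finset.univ
      fun j _ => measurableSet_singleton _, ENNReal.toReal_prod]
    exact Finset.prod_congr rfl fun j _ => hX.law j (s j)
  have hsub : {ω | B fun j => X j ω}
      ⊆ ⋃ s ∈ Finset.univ.filter B, {ω | (fun j => X j ω) = s} := fun ω hω => by
    simpa using hω
  refine (measureReal_mono hsub (measure_ne_top _ _)).trans ((measureReal_biUnion_finset_le _ _).trans (le_of_eq ?_))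
  exact Finset.sum_congr rfl fun s _ => hs s

variable {n : ℕ} {ℓ : Fin n → ℝ}

theorem sampleProb_nonneg (hℓ : ∀ i, 0 ≤ ℓ i) (i : Fin n) : 0 ≤ sampleProb ℓ i :=
  div_nonneg (hℓ i) (Finset.sum_nonneg fun j _ => hℓ j)

theorem sum_sampleProb (hs : 0 < ∑ i, ℓ i) : ∑ i, sampleProb ℓ i = 1 := by
  simp only [sampleProb]
  rw [← Finset.sum_div, div_self hs.ne']

theorem samplingMatrix_transpose_mulVec {t : ℕ} (p : Fin n → ℝ) (s : Fin t → Fin n)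
    (z : Fin n → ℝ) (j : Fin t) :
    ((samplingMatrix p s)ᵀ *ᵥ z) j = 1 / √(t * p (s j)) * z (s j) := by
  simp [samplingMatrix, Matrix.mulVec, dotProduct]

/-- The rows of `W`, scaled as by the sampling matrix. -/
noncomputable def scaledRow {ι : Type*} (t : ℕ) (p : Fin n → ℝ) (W : Matrix (Fin n) ι ℝ)
    (i : Fin n) : ι → ℝ := (1 / √(t * p i)) • W i

variable {ι : Type*} [Fintype ι]

theorem sum_scaledRow_dotProduct_sq {t : ℕ} (p : Fin n → ℝ) (W : Matrix (Fin n) ι ℝ)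
    (s : Fin t → Fin n) (x : ι → ℝ) :
    ∑ j, (scaledRow t p W (s j) ⬝ᵥ x) ^ 2
      = ((samplingMatrix p s)ᵀ *ᵥ (W *ᵥ x)) ⬝ᵥ ((samplingMatrix p s)ᵀ *ᵥ (W *ᵥ x)) := by
  refine Finset.sum_congr rfl fun j _ => ?_
  rw [samplingMatrix_transpose_mulVec, scaledRow, smul_dotProduct, smul_eq_mul, ← sq]
  rfl

/-- Rows bounded by `B ℓ i` become, after scaling, vectors of squared norm at most `B / G`. -/
theorem scaledRow_dotProduct_self_le (hℓ : ∀ i, 0 ≤ ℓ i) (hs : 0 < ∑ i, ℓ i) {t : ℕ} {G B : ℝ}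
    (hG : 0 < G) (hB : 0 ≤ B) (ht : G * ∑ i, ℓ i ≤ t) {W : Matrix (Fin n) ι ℝ}
    (hW : ∀ i, W i ⬝ᵥ W i ≤ B * ℓ i) (i : Fin n) :
    scaledRow t (sampleProb ℓ) W i ⬝ᵥ scaledRow t (sampleProb ℓ) W i ≤ B / G := by
  have hp := sampleProb_nonneg hℓ i
  rw [scaledRow, smul_dotProduct, dotProduct_smul, smul_eq_mul, smul_eq_mul, ← mul_assoc, ← sq,
    div_pow, one_pow, Real.sq_sqrt (by positivity)]
  have h1 : G * ℓ i ≤ t * sampleProb ℓ i := by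
    rw [sampleProb, mul_div_assoc', le_div_iff₀ hs]
    nlinarith [mul_le_mul_of_nonneg_right ht (hℓ i)]
  rcases (hℓ i).eq_or_lt with h0 | h0
  · have : W i ⬝ᵥ W i = 0 := le_antisymm (by simpa [← h0] using hW i) (dotProduct_self_nonneg _)
    rw [this, mul_zero]
    positivity
  · have h2 : 0 < t * sampleProb ℓ i := lt_of_lt_of_le (by positivity) h1
    rw [one_div, inv_mul_le_iff₀ h2, mul_div_assoc', le_div_iff₀ hG]
    calc W i ⬝ᵥ W i * G ≤ B * ℓ i * G := mul_le_mul_of_nonneg_right (hW i) hG.le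
      _ = G * ℓ i * B := by ring
      _ ≤ _ := mul_le_mul_of_nonneg_right h1 hB

/-- A sampled row is unbiased for `(1 / t) Wᵀ W`. The rows of probability zero vanish. -/
theorem sum_sampleProb_mul_scaledRow_sq (hℓ : ∀ i, 0 ≤ ℓ i) (hs : 0 < ∑ i, ℓ i) {t : ℕ}
    (ht : 0 < t) {B : ℝ} {W : Matrix (Fin n) ι ℝ} (hW : ∀ i, W i ⬝ᵥ W i ≤ B * ℓ i) (x : ι → ℝ) :
    ∑ i, sampleProb ℓ i * (scaledRow t (sampleProb ℓ) W i ⬝ᵥ x) ^ 2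
      = 1 / t * ((W *ᵥ x) ⬝ᵥ (W *ᵥ x)) := by
  have ht' : (0 : ℝ) < t := by exact_mod_cast ht
  rw [dotProduct, Finset.mul_sum]
  refine Finset.sum_congr rfl fun i _ => ?_
  have hp := sampleProb_nonneg hℓ i
  change _ = 1 / (t : ℝ) * ((W i ⬝ᵥ x) * (W i ⬝ᵥ x))
  rw [scaledRow, smul_dotProduct, smul_eq_mul, mul_pow, div_pow, one_pow,
    Real.sq_sqrt (by positivity)]
  rcases (hℓ i).eq_or_lt with h0 | h0
  · have : W i ⬝ᵥ W i = 0 := le_antisymm (by simpa [← h0] using hW i) (dotProduct_self_nonneg _)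
    rw [dotProduct_self_eq_zero] at this
    simp [this]
  · have h2 : 0 < sampleProb ℓ i := div_pos h0 hs
    field_simp

variable [DecidableEq ι] {Ω : Type*} [MeasurableSpace Ω] {μ : Measure Ω} [IsProbabilityMeasure μ]
  {t : ℕ} {X : Fin t → Ω → Fin n}

theorem measureReal_upper_tail_le (hX : IsIIDSample μ (sampleProb ℓ) X) (hℓ : ∀ i, 0 ≤ ℓ i)
    (hs : 0 < ∑ i, ℓ i) (ht0 : 0 < t) {G B M : ℝ} (hG : 0 < G) (hB : 0 ≤ B) (hM : 0 ≤ M)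
    (ht : G * ∑ i, ℓ i ≤ t) {W : Matrix (Fin n) ι ℝ} (hW : ∀ i, W i ⬝ᵥ W i ≤ B * ℓ i)
    (hWM : ∀ x, (W *ᵥ x) ⬝ᵥ (W *ᵥ x) ≤ M * (x ⬝ᵥ x)) {b θ : ℝ} (hb : 0 ≤ b) (hθ : 0 < θ) :
    μ.real {ω | ¬ ∀ x, ((samplingMatrix (sampleProb ℓ) fun j => X j ω)ᵀ *ᵥ (W *ᵥ x)) ⬝ᵥ
        ((samplingMatrix (sampleProb ℓ) fun j => X j ω)ᵀ *ᵥ (W *ᵥ x)) ≤ b * (x ⬝ᵥ x)}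
      ≤ Fintype.card ι * Real.exp (θ * (M * Real.exp (θ * (B / G)) - b)) := by
  classical
  have ht' : (0 : ℝ) < t := by exact_mod_cast ht0
  have h1 := hX.measureReal_le fun s => ¬ ∀ x, ((samplingMatrix (sampleProb ℓ) s)ᵀ *ᵥ
    (W *ᵥ x)) ⬝ᵥ ((samplingMatrix (sampleProb ℓ) s)ᵀ *ᵥ (W *ᵥ x)) ≤ b * (x ⬝ᵥ x)
  have h2 := chernoff_upper (v := scaledRow t (sampleProb ℓ) W) (β := M / t)
    (sampleProb_nonneg hℓ) (sum_sampleProb hs)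
    (scaledRow_dotProduct_self_le hℓ hs hG hB ht hW)
    (fun x => by
      rw [sum_sampleProb_mul_scaledRow_sq hℓ hs ht0 hW, div_mul_eq_mul_div, one_mul,
        div_mul_eq_mul_div]
      exact div_le_div_of_nonneg_right (hWM x) ht'.le) (by positivity) hb hθ t
  simp only [sum_scaledRow_dotProduct_sq, mul_div_cancel₀ _ ht'.ne'] at h2
  refine h1.trans (le_trans (le_of_eq ?_) h2)
  congr!

theorem measureReal_lower_tail_le (hX : IsIIDSample μ (sampleProb ℓ) X) (hℓ : ∀ i, 0 ≤ ℓ i)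
    (hs : 0 < ∑ i, ℓ i) (ht0 : 0 < t) {G B M : ℝ} (hG : 0 < G) (hB : 0 ≤ B) (hM : 0 ≤ M)
    (ht : G * ∑ i, ℓ i ≤ t) {W : Matrix (Fin n) ι ℝ} (hW : ∀ i, W i ⬝ᵥ W i ≤ B * ℓ i)
    (hWM : ∀ x, M * (x ⬝ᵥ x) ≤ (W *ᵥ x) ⬝ᵥ (W *ᵥ x)) (b : ℝ) {θ : ℝ} (hθ : 0 < θ) :
    μ.real {ω | ¬ ∀ x, b * (x ⬝ᵥ x) ≤
        ((samplingMatrix (sampleProb ℓ) fun j => X j ω)ᵀ *ᵥ (W *ᵥ x)) ⬝ᵥ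
        ((samplingMatrix (sampleProb ℓ) fun j => X j ω)ᵀ *ᵥ (W *ᵥ x))}
      ≤ Fintype.card ι * Real.exp (θ * (b - M * Real.exp (-(θ * (B / G))))) := by
  classical
  have ht' : (0 : ℝ) < t := by exact_mod_cast ht0
  have h1 := hX.measureReal_le fun s => ¬ ∀ x, b * (x ⬝ᵥ x) ≤
    ((samplingMatrix (sampleProb ℓ) s)ᵀ *ᵥ (W *ᵥ x)) ⬝ᵥ
      ((samplingMatrix (sampleProb ℓ) s)ᵀ *ᵥ (W *ᵥ x))
  have h2 := chernoff_lower (v := scaledRow t (sampleProb ℓ) W) (β := M / t)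
    (sampleProb_nonneg hℓ) (sum_sampleProb hs)
    (scaledRow_dotProduct_self_le hℓ hs hG hB ht hW) (by positivity)
    (fun x => by
      rw [sum_sampleProb_mul_scaledRow_sq hℓ hs ht0 hW, div_mul_eq_mul_div, one_div,
        inv_mul_eq_div]
      exact div_le_div_of_nonneg_right (hWM x) ht'.le) (by positivity) b hθ t
  simp only [sum_scaledRow_dotProduct_sq, mul_div_cancel₀ _ ht'.ne'] at h2
  refine h1.trans (le_trans (le_of_eq ?_) h2)
  congr!

/-- Failure probability of a `δ`-embedding of the column space of `W`, where `WᵀW = I`. The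
exponent `θ = δ G` makes `θ` times the norm bound `1 / (2 G)` equal to `δ / 2`. -/
theorem measureReal_not_embedding_le (hX : IsIIDSample μ (sampleProb ℓ) X) (hℓ : ∀ i, 0 ≤ ℓ i)
    (hs : 0 < ∑ i, ℓ i) (ht0 : 0 < t) {G : ℝ} (hG : 0 < G)
    (ht : G * ∑ i, ℓ i ≤ t) {W : Matrix (Fin n) ι ℝ} (hW : ∀ i, W i ⬝ᵥ W i ≤ 1 / 2 * ℓ i)
    (hWM : ∀ x, (W *ᵥ x) ⬝ᵥ (W *ᵥ x) = x ⬝ᵥ x) {δ : ℝ} (hδ : 0 < δ) (hδ1 : δ ≤ 1 / 4) :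
    μ.real {ω | ¬ ∀ x, (1 - δ) * (x ⬝ᵥ x) ≤
        ((samplingMatrix (sampleProb ℓ) fun j => X j ω)ᵀ *ᵥ (W *ᵥ x)) ⬝ᵥ
          ((samplingMatrix (sampleProb ℓ) fun j => X j ω)ᵀ *ᵥ (W *ᵥ x)) ∧
        ((samplingMatrix (sampleProb ℓ) fun j => X j ω)ᵀ *ᵥ (W *ᵥ x)) ⬝ᵥ
          ((samplingMatrix (sampleProb ℓ) fun j => X j ω)ᵀ *ᵥ (W *ᵥ x)) ≤ (1 + δ) * (x ⬝ᵥ x)}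
      ≤ 2 * (Fintype.card ι * Real.exp (-(δ ^ 2 * G / 4))) := by
  have hθ : 0 < δ * G := by positivity
  have eL : δ * G * (1 / 2 / G) = δ / 2 := by field_simp
  have u := measureReal_upper_tail_le hX hℓ hs ht0 hG (by norm_num) zero_le_one ht hW
    (fun x => by rw [one_mul]; exact (hWM x).le) (by linarith : 0 ≤ 1 + δ) hθ
  have l := measureReal_lower_tail_le hX hℓ hs ht0 hG (by norm_num) zero_le_one ht hW
    (fun x => by rw [one_mul]; exact (hWM x).ge) (1 - δ) hθ
  rw [eL, one_mul] at u l
  have xu : Real.exp (δ / 2) ≤ 1 + 3 / 4 * δ := by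
    have h1 : 1 - δ / 2 ≤ Real.exp (-(δ / 2)) := by
      linarith [Real.add_one_le_exp (-(δ / 2))]
    rw [Real.exp_neg, le_inv_comm₀ (by linarith) (Real.exp_pos _)] at h1
    refine h1.trans ?_
    rw [inv_le_iff_one_le_mul₀ (by linarith)]
    nlinarith
  have xl : 1 - δ / 2 ≤ Real.exp (-(δ / 2)) := by linarith [Real.add_one_le_exp (-(δ / 2))]
  have u' : Real.exp (δ * G * (Real.exp (δ / 2) - (1 + δ))) ≤ Real.exp (-(δ ^ 2 * G / 4)) := by
    apply Real.exp_le_exp.2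
    calc δ * G * (Real.exp (δ / 2) - (1 + δ)) ≤ δ * G * (-(δ / 4)) :=
          mul_le_mul_of_nonneg_left (by linarith) hθ.le
      _ = _ := by ring
  have l' : Real.exp (δ * G * (1 - δ - Real.exp (-(δ / 2)))) ≤ Real.exp (-(δ ^ 2 * G / 4)) := by
    apply Real.exp_le_exp.2
    calc δ * G * (1 - δ - Real.exp (-(δ / 2))) ≤ δ * G * (-(δ / 4)) :=
          mul_le_mul_of_nonneg_left (by linarith) hθ.le
      _ = _ := by ring
  have cu := mul_le_mul_of_nonneg_left u' (Nat.cast_nonneg (α := ℝ) (Fintype.card ι))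
  have cl := mul_le_mul_of_nonneg_left l' (Nat.cast_nonneg (α := ℝ) (Fintype.card ι))
  refine le_trans (measureReal_mono ?_) ((measureReal_union_le _ _).trans
    ((add_le_add (l.trans cl) (u.trans cu)).trans (le_of_eq (by ring))))
  intro ω hω
  simp only [Set.mem_ofPred_eq, Set.mem_union, forall_and] at hω ⊢
  tauto

/-- Upper tail for rows whose norms are controlled by `h`: with `θ = 2 G / h` the exponent is
`2 G (e - 4) ≤ -2 G`. For `h = 0` the rows vanish. -/
theorem measureReal_not_bounded_le (hX : IsIIDSample μ (sampleProb ℓ) X) (hℓ : ∀ i, 0 ≤ ℓ i)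
    (hs : 0 < ∑ i, ℓ i) (ht0 : 0 < t) {G h : ℝ} (hG : 0 < G) (hh : 0 ≤ h)
    (ht : G * ∑ i, ℓ i ≤ t) {W : Matrix (Fin n) ι ℝ} (hW : ∀ i, W i ⬝ᵥ W i ≤ h / 2 * ℓ i)
    (hWM : ∀ x, (W *ᵥ x) ⬝ᵥ (W *ᵥ x) ≤ h * (x ⬝ᵥ x)) :
    μ.real {ω | ¬ ∀ x, ((samplingMatrix (sampleProb ℓ) fun j => X j ω)ᵀ *ᵥ (W *ᵥ x)) ⬝ᵥ
        ((samplingMatrix (sampleProb ℓ) fun j => X j ω)ᵀ *ᵥ (W *ᵥ x)) ≤ 4 * h * (x ⬝ᵥ x)}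
      ≤ Fintype.card ι * Real.exp (-(2 * G)) := by
  rcases hh.eq_or_lt with h0 | h0
  · have : {ω | ¬ ∀ x, ((samplingMatrix (sampleProb ℓ) fun j => X j ω)ᵀ *ᵥ (W *ᵥ x)) ⬝ᵥ
        ((samplingMatrix (sampleProb ℓ) fun j => X j ω)ᵀ *ᵥ (W *ᵥ x)) ≤ 4 * h * (x ⬝ᵥ x)}
        = ∅ := by
      refine Set.eq_empty_of_forall_notMem fun ω hω => hω fun x => ?_
      have h1 : (W *ᵥ x) ⬝ᵥ (W *ᵥ x) = 0 :=
        le_antisymm (by simpa [← h0] using hWM x) (dotProduct_self_nonneg _)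
      rw [dotProduct_self_eq_zero] at h1
      rw [h1, ← h0]
      simp
    rw [this, measureReal_empty]
    positivity
  · have u := measureReal_upper_tail_le hX hℓ hs ht0 hG (by positivity) hh ht hW hWM
      (by positivity : 0 ≤ 4 * h) (by positivity : 0 < 2 * G / h)
    refine u.trans (mul_le_mul_of_nonneg_left (Real.exp_le_exp.2 ?_) (Nat.cast_nonneg _))
    have e1 : 2 * G / h * (h / 2 / G) = 1 := by field_simp
    rw [e1]
    have e2 : 2 * G / h * (h * Real.exp 1 - 4 * h) = 2 * G * (Real.exp 1 - 4) := by field_simp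
    rw [e2]
    nlinarith [Real.exp_one_lt_d9]

end Sampling

/-! ### The sketch with ridge leverage score sampling -/

theorem Matrix.PosSemidef.exists_isOrthDiag_nonneg {n : ℕ} {A : Matrix (Fin n) (Fin n) ℝ}
    (hA : A.PosSemidef) : ∃ U a, IsOrthDiag A U a ∧ ∀ l, 0 ≤ a l := by
  have hAt : Aᵀ = A := by
    rw [← Matrix.conjTranspose_eq_transpose_of_trivial]; exact hA.isHermitian
  obtain ⟨U, a, hd⟩ := exists_isOrthDiag hAt
  refine ⟨U, a, hd, fun l => ?_⟩
  rw [← hd.quadForm_col l]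
  simpa using hA.dotProduct_mulVec_nonneg fun i => U i l

section Rows

variable {n : ℕ} {A U : Matrix (Fin n) (Fin n) ℝ} {a : Fin n → ℝ}

theorem sum_subtype_eq_of_forall {P : Fin n → Prop} [DecidablePred P] {f : Fin n → ℝ}
    (hf : ∀ l, ¬ P l → f l = 0) : ∑ l : {l // P l}, f l = ∑ l, f l := by
  rw [← Finset.sum_subtype (Finset.univ.filter P) (by simp) f]
  exact Finset.sum_filter_of_ne fun l _ hl => by
    by_contra h
    exact hl (hf l h)

/-- The eigenvectors with eigenvalue above `h`, as columns. -/
def highPart (U : Matrix (Fin n) (Fin n) ℝ) (a : Fin n → ℝ) (h : ℝ) :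
    Matrix (Fin n) {l // h < a l} ℝ := U.submatrix id Subtype.val

/-- `U diag(b)`, where `b` is the square root of the part of the spectrum up to `h`. -/
noncomputable def lowPart (U : Matrix (Fin n) (Fin n) ℝ) (a : Fin n → ℝ) (h : ℝ) :
    Matrix (Fin n) (Fin n) ℝ := U * Matrix.diagonal (lowSqrt a h)

theorem lowPart_mulVec (U : Matrix (Fin n) (Fin n) ℝ) (a : Fin n → ℝ) (h : ℝ) (x : Fin n → ℝ) :
    lowPart U a h *ᵥ x = U *ᵥ fun l => lowSqrt a h l * x l := by
  rw [lowPart, ← Matrix.mulVec_mulVec]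
  congr 1
  funext l
  rw [Matrix.mulVec_diagonal]

theorem highPart_dotProduct (hd : IsOrthDiag A U a) (h : ℝ) (x : {l // h < a l} → ℝ) :
    (highPart U a h *ᵥ x) ⬝ᵥ (highPart U a h *ᵥ x) = x ⬝ᵥ x := by
  have : (highPart U a h)ᵀ * highPart U a h = 1 := by
    ext i j
    have := hd.transpose_apply_sum i j
    simpa [Matrix.mul_apply, highPart, Matrix.one_apply, Subtype.ext_iff] using this
  rw [Matrix.dotProduct_mulVec, ← Matrix.mulVec_transpose, Matrix.mulVec_mulVec, this,
    Matrix.one_mulVec]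

theorem lowPart_dotProduct_le (hd : IsOrthDiag A U a) (ha : ∀ l, 0 ≤ a l) {h : ℝ} (hh : 0 ≤ h)
    (x : Fin n → ℝ) : (lowPart U a h *ᵥ x) ⬝ᵥ (lowPart U a h *ᵥ x) ≤ h * (x ⬝ᵥ x) := by
  rw [lowPart_mulVec, dotProduct_mulVec_orth hd, dotProduct, dotProduct, Finset.mul_sum]
  refine Finset.sum_le_sum fun l _ => ?_
  have := mul_le_mul_of_nonneg_right (lowSqrt_sq_le ha hh l) (mul_self_nonneg (x l))
  linarith

/-- `PreservesHigh` in the coordinates of the eigenvalues above `h`. -/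
theorem preservesHigh_of_forall {t : ℕ} {S : Matrix (Fin n) (Fin t) ℝ} {h δ : ℝ}
    (H : ∀ x, (1 - δ) * (x ⬝ᵥ x) ≤ (Sᵀ *ᵥ (highPart U a h *ᵥ x)) ⬝ᵥ
          (Sᵀ *ᵥ (highPart U a h *ᵥ x)) ∧
        (Sᵀ *ᵥ (highPart U a h *ᵥ x)) ⬝ᵥ (Sᵀ *ᵥ (highPart U a h *ᵥ x)) ≤ (1 + δ) * (x ⬝ᵥ x)) :
    PreservesHigh U a h δ S := by
  intro y hy
  have e1 : highPart U a h *ᵥ (fun l => y l.1) = U *ᵥ y := by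
    funext i
    exact sum_subtype_eq_of_forall (P := fun l => h < a l) (f := fun l => U i l * y l)
      fun l hl => by rw [hy l (not_lt.1 hl), mul_zero]
  have e2 : (fun l : {l // h < a l} => y l.1) ⬝ᵥ (fun l => y l.1) = y ⬝ᵥ y :=
    sum_subtype_eq_of_forall (P := fun l => h < a l) (f := fun l => y l * y l)
      fun l hl => by rw [hy l (not_lt.1 hl), mul_zero]
  have := H fun l => y l.1
  rwa [e1, e2] at this

/-- Above `h` the ridge leverage scores lose at most a factor `2 g`, as the ridge parameter is at
most `g h`. -/
theorem highPart_row_le (hd : IsOrthDiag A U a) (ha : ∀ l, 0 ≤ a l) {h g : ℝ} {k : ℕ}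
    (hh : 0 ≤ h) (hg : 1 ≤ g) (hr : ridgeParam A k ≤ g * h) (i : Fin n) :
    highPart U a h i ⬝ᵥ highPart U a h i ≤ 2 * g * ridgeScore (psdSqrt A) k i := by
  have hr0 := ridgeParam_nonneg A k
  rw [ridgeScore_eq hd ha, Finset.mul_sum]
  calc highPart U a h i ⬝ᵥ highPart U a h i
      = ∑ l : {l // h < a l}, (fun l => if h < a l then U i l ^ 2 else 0) l.1 :=
        Finset.sum_congr rfl fun l _ => by simp [highPart, l.2, sq]
    _ = ∑ l, if h < a l then U i l ^ 2 else 0 :=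
        sum_subtype_eq_of_forall (P := fun l => h < a l)
          (f := fun l => if h < a l then U i l ^ 2 else 0) fun l hl => if_neg hl
    _ ≤ _ := by
        refine Finset.sum_le_sum fun l _ => ?_
        rw [← mul_assoc]
        split_ifs with hl
        · refine le_mul_of_one_le_left (sq_nonneg _) ?_
          have h1 : 0 < a l := lt_of_le_of_lt hh hl
          rw [mul_div_assoc', le_div_iff₀ (by linarith)]
          nlinarith
        · exact mul_nonneg (mul_nonneg (by linarith)
            (div_nonneg (ha l) (add_nonneg (ha l) hr0))) (sq_nonneg _)

/-- On eigenvalues `a l ≤ h` one has `a l ≤ (h + r) · a l / (a l + r)` for the ridge parameter `r`,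
and `h + r ≤ 2 g h`. -/
theorem lowPart_row_le (hd : IsOrthDiag A U a) (ha : ∀ l, 0 ≤ a l) {h g : ℝ} {k : ℕ}
    (hh : 0 ≤ h) (hg : 1 ≤ g) (hr : ridgeParam A k ≤ g * h) (i : Fin n) :
    lowPart U a h i ⬝ᵥ lowPart U a h i ≤ 2 * g * h * ridgeScore (psdSqrt A) k i := by
  have hr0 := ridgeParam_nonneg A k
  rw [ridgeScore_eq hd ha, Finset.mul_sum]
  refine Finset.sum_le_sum fun l _ => ?_
  have e1 : lowPart U a h i l * lowPart U a h i l = lowSqrt a h l ^ 2 * U i l ^ 2 := by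
    rw [lowPart, Matrix.mul_diagonal]; ring
  rw [e1, ← mul_assoc]
  refine mul_le_mul_of_nonneg_right ?_ (sq_nonneg _)
  have h2 : 0 ≤ 2 * g * h * (a l / (a l + ridgeParam A k)) :=
    mul_nonneg (by positivity) (div_nonneg (ha l) (add_nonneg (ha l) hr0))
  unfold lowSqrt
  split_ifs with hl
  · rw [Real.sq_sqrt (ha l)]
    rcases (ha l).eq_or_lt with h0 | h0
    · rwa [← h0] at h2 ⊢
    · rw [mul_div_assoc', le_div_iff₀ (by linarith)]
      have : a l + ridgeParam A k ≤ 2 * g * h := by nlinarith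
      nlinarith
  · simpa using h2

end Rows

section Parameters

variable {n k : ℕ} {ε c : ℝ} {A U : Matrix (Fin n) (Fin n) ℝ} {a : Fin n → ℝ}

/-- The eigenvalue threshold `ε √(F / k) / 10` with `F = ‖A - A_k‖_F²`. -/
noncomputable def eigThreshold (A : Matrix (Fin n) (Fin n) ℝ) (k : ℕ) (ε : ℝ) : ℝ :=
  ε * √(lowRankErrSq A k / k) / 10

theorem eigThreshold_nonneg (A : Matrix (Fin n) (Fin n) ℝ) (k : ℕ) (hε : 0 < ε) :
    0 ≤ eigThreshold A k ε := by
  unfold eigThreshold; positivity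

theorem eigThreshold_sq (A : Matrix (Fin n) (Fin n) ℝ) (k : ℕ) (ε : ℝ) :
    eigThreshold A k ε ^ 2 = ε ^ 2 * (lowRankErrSq A k / k) / 100 := by
  have := Real.sq_sqrt (div_nonneg (lowRankErrSq_nonneg A k) (Nat.cast_nonneg (α := ℝ) k))
  rw [eigThreshold, div_pow, mul_pow, this]
  norm_num

/-- The rank parameter `k'` is of order `k / ε²`, which makes the ridge parameter at most the
threshold times the oversampling factor `g = ε √(n / k)`. -/
theorem ridgeParam_le_threshold (hd : IsOrthDiag A U a) (ha : ∀ l, 0 ≤ a l) (hk : 1 ≤ k)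
    (hε : 0 < ε) (hε1 : ε < 1) (hc : 20 ≤ c) :
    ridgeParam A (rankParam c ε k) ≤ ε * √((n : ℝ) / k) * eigThreshold A k ε := by
  have hk0 : (1 : ℝ) ≤ k := by exact_mod_cast hk
  have hF := lowRankErrSq_nonneg A k
  have hr0 := ridgeParam_nonneg A (rankParam c ε k)
  have hk' : 20 * k / ε ^ 2 ≤ (rankParam c ε k : ℝ) := by
    refine le_trans ?_ (Nat.le_ceil _)
    gcongr
  have hε2 : ε ^ 2 ≤ 1 := pow_le_one₀ hε.le hε1.le
  have h20 : (20 * k : ℝ) ≤ rankParam c ε k :=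
    le_trans (le_div_self (by positivity) (by positivity) hε2) hk'
  have h2k : 2 * k ≤ rankParam c ε k := by
    have : ((2 * k : ℕ) : ℝ) ≤ rankParam c ε k := by push_cast; linarith
    exact_mod_cast this
  have h1 := mul_ridgeParam_le hd ha h2k (by omega)
  set s := √(n * lowRankErrSq A k) with hs
  have h2 : √(2 * n * lowRankErrSq A k) ≤ 2 * s := by
    rw [hs, Real.sqrt_le_left (by positivity), mul_pow, Real.sq_sqrt (by positivity)]
    nlinarith [mul_nonneg (Nat.cast_nonneg (α := ℝ) n) hF]
  have h3 : √((n : ℝ) / k) * √(lowRankErrSq A k / k) = s / k := by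
    rw [← Real.sqrt_mul (by positivity), div_mul_div_comm, Real.sqrt_div' _ (by positivity),
      Real.sqrt_mul_self (by positivity)]
  have h4 : ε * √((n : ℝ) / k) * eigThreshold A k ε = ε ^ 2 * s / (10 * k) := by
    rw [eigThreshold]
    calc _ = ε ^ 2 * (√((n : ℝ) / k) * √(lowRankErrSq A k / k)) / 10 := by ring
      _ = _ := by rw [h3]; field_simp
  rw [h4, le_div_iff₀ (by positivity)]
  have h5 : 20 * k / ε ^ 2 * ridgeParam A (rankParam c ε k) ≤ 2 * s :=
    (mul_le_mul_of_nonneg_right hk' hr0).trans (h1.trans h2)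
  rw [div_mul_eq_mul_div, div_le_iff₀ (by positivity)] at h5
  linarith

/-- The oversampling factor of the scores; this is where `n ≥ k / ε²` enters. -/
theorem one_le_oversampling (hk : 1 ≤ k) (hε : 0 < ε) (hn : (k : ℝ) / ε ^ 2 ≤ n) :
    1 ≤ ε * √((n : ℝ) / k) := by
  have hk0 : (1 : ℝ) ≤ k := by exact_mod_cast hk
  rw [div_le_iff₀ (by positivity)] at hn
  have : 1 / ε ≤ √((n : ℝ) / k) := by
    apply Real.le_sqrt_of_sq_le
    rw [div_pow, one_pow, div_le_div_iff₀ (by positivity) (by positivity)]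
    linarith
  rwa [div_le_iff₀' hε] at this

end Parameters

/-- Matrices without columns: this covers the degenerate sample count `t = 0`. -/
theorem isSpectralPCP_of_eq_zero {m n t : ℕ} {ε F : ℝ} {k : ℕ} (ht : t = 0) (hε : 0 < ε)
    (hε1 : ε < 1) (hF : 0 ≤ F) (C : Matrix (Fin n) (Fin t) ℝ) (B : Matrix (Fin m) (Fin t) ℝ) :
    IsSpectralPCP ε k F C B := by
  have hx : ∀ x : Fin t → ℝ, x = 0 := fun x => funext fun j => absurd j.2 (by omega)
  refine isSpectralPCP_of_forall hε hε1 le_rfl (by positivity) (fun x => ?_) fun x => ?_ <;>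
  simp [hx x]

theorem four_mul_exp_le {n : ℕ} (hn : 2 ≤ n) (d : ℝ) :
    4 * (n * Real.exp (-((d + 3) * Real.log n))) ≤ 1 / (n : ℝ) ^ d := by
  have hn2 : (2 : ℝ) ≤ n := by exact_mod_cast hn
  have hn0 : (0 : ℝ) < n := by linarith
  have e1 : Real.exp (-((d + 3) * Real.log n)) = 1 / (n : ℝ) ^ d * (1 / (n : ℝ) ^ 3) := by
    rw [Real.exp_neg, add_mul, Real.exp_add, mul_comm d, ← Real.rpow_def_of_pos hn0]
    have : Real.exp (3 * Real.log n) = (n : ℝ) ^ 3 := by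
      have := Real.exp_nat_mul (Real.log n) 3
      rw [Real.exp_log hn0] at this
      exact_mod_cast this
    rw [this, mul_inv, one_div, one_div]
  rw [e1]
  have hp : 0 < 1 / (n : ℝ) ^ d := by positivity
  have : 4 * (n * (1 / (n : ℝ) ^ 3)) ≤ 1 := by
    have h4 : (4 : ℝ) ≤ n ^ 2 := by nlinarith
    have h5 : 4 * (n * (1 / (n : ℝ) ^ 3)) = 4 / (n : ℝ) ^ 2 := by field_simp
    rw [h5]
    exact div_le_one_of_le₀ h4 (by positivity)
  calc _ = 1 / (n : ℝ) ^ d * (4 * (n * (1 / (n : ℝ) ^ 3))) := by ring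
    _ ≤ 1 / (n : ℝ) ^ d * 1 := mul_le_mul_of_nonneg_left this hp.le
    _ = _ := mul_one _

/-- A union bound which needs no measurability of the good event `s`. -/
theorem one_sub_le_measureReal {Ω : Type*} [MeasurableSpace Ω] {μ : Measure Ω}
    [IsProbabilityMeasure μ] {s b₁ b₂ b₃ : Set Ω} {r₁ r₂ r₃ : ℝ} (h₁ : μ.real b₁ ≤ r₁)
    (h₂ : μ.real b₂ ≤ r₂) (h₃ : μ.real b₃ ≤ r₃) (h : sᶜ ⊆ b₁ ∪ b₂ ∪ b₃) :
    1 - (r₁ + r₂ + r₃) ≤ μ.real s := by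
  have e1 : 1 ≤ μ.real s + μ.real sᶜ := by
    have := measureReal_union_le (μ := μ) s sᶜ
    rwa [Set.union_compl_self, probReal_univ] at this
  have e2 : μ.real sᶜ ≤ μ.real (b₁ ∪ b₂) + μ.real b₃ :=
    (measureReal_mono h (measure_ne_top _ _)).trans (measureReal_union_le _ _)
  have e3 := measureReal_union_le (μ := μ) b₁ b₂
  linarith

/-- Three good events suffice: `S₂` preserves the high part of `A`, and both `S₁` and `S₂` bound the
low part. The joint law of the two samples does not enter. -/
theorem measureReal_isSpectralPCP {d c c' : ℝ} (hd0 : 0 < d) (hc : 20 ≤ c)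
    (hc' : 64 * (d + 3) ≤ c') {n k : ℕ} {ε : ℝ} (hk : 1 ≤ k) (hε : 0 < ε) (hε1 : ε < 1)
    (hn : (k : ℝ) / ε ^ 2 ≤ n) {A : Matrix (Fin n) (Fin n) ℝ} (hA : A.PosSemidef)
    {τ : Fin n → ℝ} (hτ : ∀ i, ridgeScore (psdSqrt A) (rankParam c ε k) i ≤ τ i)
    {ℓ : Fin n → ℝ} (hℓdef : ℓ = scaledScore ε k τ) {t : ℕ} (htdef : t = sampleCount c' ε ℓ)
    {Ω : Type*} [MeasurableSpace Ω] (μ : Measure Ω) [IsProbabilityMeasure μ]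
    {X₁ X₂ : Fin t → Ω → Fin n}
    (h₁ : IsIIDSample μ (sampleProb ℓ) X₁) (h₂ : IsIIDSample μ (sampleProb ℓ) X₂) :
    1 - 1 / (n : ℝ) ^ d ≤ μ.real {ω | IsSpectralPCP ε k (lowRankErrSq A k)
      (A * samplingMatrix (sampleProb ℓ) fun j => X₁ j ω)
      ((samplingMatrix (sampleProb ℓ) fun j => X₂ j ω)ᵀ * A *
        samplingMatrix (sampleProb ℓ) fun j => X₁ j ω)} := by
  obtain ⟨U, a, hd, ha⟩ := hA.exists_isOrthDiag_nonneg
  have hk0 : (1 : ℝ) ≤ k := by exact_mod_cast hk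
  have hn2 : 2 ≤ n := by
    have h1 : (1 : ℝ) < n := by
      refine lt_of_lt_of_le ?_ hn
      rw [lt_div_iff₀ (by positivity), one_mul]
      exact lt_of_lt_of_le (pow_lt_one₀ hε.le hε1 two_ne_zero) hk0
    exact_mod_cast h1
  have hn2' : (2 : ℝ) ≤ n := by exact_mod_cast hn2
  have hlog : 0 < Real.log n := Real.log_pos (by linarith)
  have hF := lowRankErrSq_nonneg A k
  rcases Nat.eq_zero_or_pos t with ht0 | ht0
  · have : {ω | IsSpectralPCP ε k (lowRankErrSq A k)
      (A * samplingMatrix (sampleProb ℓ) fun j => X₁ j ω)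
      ((samplingMatrix (sampleProb ℓ) fun j => X₂ j ω)ᵀ * A *
        samplingMatrix (sampleProb ℓ) fun j => X₁ j ω)} = Set.univ :=
      Set.eq_univ_of_forall fun ω => isSpectralPCP_of_eq_zero ht0 hε hε1 hF _ _
    rw [this, probReal_univ]
    have : 0 < 1 / (n : ℝ) ^ d := by positivity
    linarith
  set g := ε * √((n : ℝ) / k) with hg
  have hg1 : 1 ≤ g := one_le_oversampling hk hε hn
  set h := eigThreshold A k ε with hh
  have hh0 : 0 ≤ h := eigThreshold_nonneg A k hε
  have hr : ridgeParam A (rankParam c ε k) ≤ g * h := ridgeParam_le_threshold hd ha hk hε hε1 hc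
  have hℓτ : ∀ i, ℓ i = 4 * g * τ i := fun i => by
    rw [hℓdef, scaledScore, hg]; ring
  have hℓ : ∀ i, 0 ≤ ℓ i := fun i => by
    rw [hℓτ]
    exact mul_nonneg (by linarith) ((ridgeScore_nonneg hd ha _ i).trans (hτ i))
  set G := c' * Real.log n / ε ^ 2 with hG
  have hc'0 : 0 < c' := by linarith
  have hG0 : 0 < G := by positivity
  have ht : G * ∑ i, ℓ i ≤ t := by rw [htdef]; exact Nat.le_ceil _
  have hs : 0 < ∑ i, ℓ i := by
    rw [htdef] at ht0
    have h1 : 0 < G * ∑ i, ℓ i := Nat.ceil_pos.1 ht0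
    exact pos_of_mul_pos_right h1 hG0.le
  have wH : ∀ i, highPart U a h i ⬝ᵥ highPart U a h i ≤ 1 / 2 * ℓ i := fun i => by
    refine (highPart_row_le hd ha hh0 hg1 hr i).trans ?_
    rw [hℓτ]
    have := mul_le_mul_of_nonneg_left (hτ i) (by linarith : 0 ≤ 2 * g)
    linarith
  have wL : ∀ i, lowPart U a h i ⬝ᵥ lowPart U a h i ≤ h / 2 * ℓ i := fun i => by
    refine (lowPart_row_le hd ha hh0 hg1 hr i).trans ?_
    rw [hℓτ]
    have := mul_le_mul_of_nonneg_left (hτ i) (by positivity : 0 ≤ 2 * g * h)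
    linarith
  have b1 := measureReal_not_embedding_le h₂ hℓ hs ht0 hG0 ht wH (highPart_dotProduct hd h)
    (by positivity : 0 < ε / 4) (by linarith)
  have b2 := measureReal_not_bounded_le h₁ hℓ hs ht0 hG0 hh0 ht wL
    (lowPart_dotProduct_le hd ha hh0)
  have b3 := measureReal_not_bounded_le h₂ hℓ hs ht0 hG0 hh0 ht wL
    (lowPart_dotProduct_le hd ha hh0)
  -- all exponents are at most `-(d + 3) log n`
  have hcl : 64 * ((d + 3) * Real.log n) ≤ c' * Real.log n := by
    rw [← mul_assoc]; exact mul_le_mul_of_nonneg_right hc' hlog.le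
  have hGε : (ε / 4) ^ 2 * G / 4 = c' * Real.log n / 64 := by
    rw [hG]; field_simp; norm_num
  have x1 : Real.exp (-((ε / 4) ^ 2 * G / 4)) ≤ Real.exp (-((d + 3) * Real.log n)) := by
    apply Real.exp_le_exp.2
    rw [hGε]; linarith
  have x2 : Real.exp (-(2 * G)) ≤ Real.exp (-((d + 3) * Real.log n)) := by
    apply Real.exp_le_exp.2
    have h1 : c' * Real.log n ≤ G :=
      le_div_self (by positivity) (by positivity) (pow_le_one₀ hε.le hε1.le)
    have h2 : 0 ≤ (d + 3) * Real.log n := by positivity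
    linarith
  have hcard : (Fintype.card {l // h < a l} : ℝ) ≤ n := by
    have := Fintype.card_subtype_le fun l => h < a l
    rw [Fintype.card_fin] at this
    exact_mod_cast this
  have y1 : (Fintype.card {l // h < a l} : ℝ) * Real.exp (-((ε / 4) ^ 2 * G / 4))
      ≤ n * Real.exp (-((d + 3) * Real.log n)) := by gcongr
  have y2 : (Fintype.card (Fin n) : ℝ) * Real.exp (-(2 * G))
      ≤ n * Real.exp (-((d + 3) * Real.log n)) := by
    rw [Fintype.card_fin]; gcongr
  have tot := four_mul_exp_le hn2 d
  refine le_trans ?_ (one_sub_le_measureReal b1 (b2.trans y2) (b3.trans y2) fun ω hω => ?_)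
  · linarith
  · by_contra hgood
    simp only [Set.mem_union, Set.mem_ofPred_eq, not_or, not_not] at hgood
    obtain ⟨⟨g1, g2⟩, g3⟩ := hgood
    refine hω ?_
    have key := sketch_bounds hd ha hh0 hε hε1 (preservesHigh_of_forall g1)
      (S₁ := samplingMatrix (sampleProb ℓ) fun j => X₁ j ω)
      (fun x => by rw [← lowPart_mulVec]; exact g2 x)
      (fun x => by rw [← lowPart_mulVec]; exact g3 x)
    refine isSpectralPCP_of_forall hε hε1 (by positivity) ?_ (fun x => (key x).1)
      fun x => (key x).2
    rw [hh, eigThreshold_sq]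
    have : 80 * (ε ^ 2 * (lowRankErrSq A k / k) / 100) / ε
        = 4 / 5 * (ε / k * lowRankErrSq A k) := by field_simp; ring
    rw [this]
    have : 0 ≤ ε / k * lowRankErrSq A k := by positivity
    linarith

/-- The ridge leverage scores sum to `O(k')` with `k' = O(k / ε²)`. The rounding up of the sample
count is absorbed as `n ≤ 1` makes the logarithm vanish and `n ≥ 2` bounds it below. -/
theorem sampleCount_le {c c' K : ℝ} (hc : 0 < c) (hc' : 0 < c') (hK : 1 ≤ K) {n k : ℕ} {ε : ℝ}
    (hk : 1 ≤ k) (hε : 0 < ε) (hε1 : ε < 1) {A : Matrix (Fin n) (Fin n) ℝ} (hA : A.PosSemidef)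
    {τ : Fin n → ℝ} (hτ : ∀ i, τ i ≤ K * ridgeScore (psdSqrt A) (rankParam c ε k) i) :
    (sampleCount c' ε (scaledScore ε k τ) : ℝ)
      ≤ (16 * c' * K * (c + 1) + 2) * (√((n : ℝ) * k) * Real.log n / ε ^ 3) := by
  obtain ⟨U, a, hd, ha⟩ := hA.exists_isOrthDiag_nonneg
  have hk0 : (1 : ℝ) ≤ k := by exact_mod_cast hk
  rcases Nat.lt_or_ge n 2 with hn | hn
  · have hl : Real.log n = 0 := by interval_cases n <;> simp
    simp [sampleCount, hl]
  have hn2 : (2 : ℝ) ≤ n := by exact_mod_cast hn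
  have hlog : 1 / 2 ≤ Real.log n := by
    have := Real.log_le_log two_pos hn2
    linarith [Real.log_two_gt_d9]
  set k' := rankParam c ε k with hk'
  have hε2 : ε ^ 2 ≤ 1 := pow_le_one₀ hε.le hε1.le
  have hk'le : (k' : ℝ) ≤ (c + 1) * k / ε ^ 2 := by
    have h1 : (k' : ℝ) < c * k / ε ^ 2 + 1 := Nat.ceil_lt_add_one (by positivity)
    have h2 : (1 : ℝ) ≤ k / ε ^ 2 := by rw [le_div_iff₀ (by positivity)]; linarith
    have h3 : (c + 1) * k / ε ^ 2 = c * k / ε ^ 2 + k / ε ^ 2 := by ring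
    linarith
  have hk'0 : 0 < k' := Nat.ceil_pos.2 (by positivity)
  have hsum : ∑ i, τ i ≤ K * (4 * ((c + 1) * k / ε ^ 2)) := by
    calc ∑ i, τ i ≤ ∑ i, K * ridgeScore (psdSqrt A) k' i := Finset.sum_le_sum fun i _ => hτ i
      _ = K * ∑ i, ridgeScore (psdSqrt A) k' i := by rw [Finset.mul_sum]
      _ ≤ K * (4 * k') := mul_le_mul_of_nonneg_left (sum_ridgeScore_le hd ha hk'0) (by linarith)
      _ ≤ _ := by gcongr
  have hroot : √((n : ℝ) / k) * k = √((n : ℝ) * k) := by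
    have : (n : ℝ) * k = n / k * (k * k) := by field_simp
    rw [this, Real.sqrt_mul (by positivity), Real.sqrt_mul_self (by positivity)]
  set Y := √((n : ℝ) * k) * Real.log n / ε ^ 3 with hY
  have hx : c' * Real.log n / ε ^ 2 * ∑ i, scaledScore ε k τ i ≤ 16 * c' * K * (c + 1) * Y := by
    have e1 : ∑ i, scaledScore ε k τ i = 4 * ε * √((n : ℝ) / k) * ∑ i, τ i := by
      rw [Finset.mul_sum]; rfl
    rw [e1]
    calc c' * Real.log n / ε ^ 2 * (4 * ε * √((n : ℝ) / k) * ∑ i, τ i)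
        ≤ c' * Real.log n / ε ^ 2 *
          (4 * ε * √((n : ℝ) / k) * (K * (4 * ((c + 1) * k / ε ^ 2)))) := by gcongr
      _ = 16 * c' * K * (c + 1) * ((√((n : ℝ) / k) * k) * Real.log n / ε ^ 3) := by
          field_simp; ring
      _ = _ := by rw [hroot]
  have hY2 : 1 ≤ 2 * Y := by
    have h1 : (1 : ℝ) ≤ √((n : ℝ) * k) := by
      rw [Real.one_le_sqrt]; nlinarith
    have h2 : √((n : ℝ) * k) * Real.log n ≤ Y :=
      le_div_self (by positivity) (by positivity) (pow_le_one₀ hε.le hε1.le)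
    nlinarith
  have hX0 : 0 ≤ 16 * c' * K * (c + 1) * Y := by
    have : 0 ≤ Y := by linarith
    positivity
  have hceil : (sampleCount c' ε (scaledScore ε k τ) : ℝ) ≤ 16 * c' * K * (c + 1) * Y + 1 :=
    le_trans (by exact_mod_cast Nat.ceil_mono hx) (Nat.ceil_lt_add_one hX0).le
  linarith

theorem mainTheorem6 :
    (∀ d : ℝ, 0 < d → ∃ c₀ c₀' : ℝ, 0 < c₀ ∧ 0 < c₀' ∧
      ∀ c c' : ℝ, c₀ ≤ c → c₀' ≤ c' →
      ∀ (n k : ℕ) (ε : ℝ), 1 ≤ k → 0 < ε → ε < 1 → (k : ℝ) / ε ^ 2 ≤ n →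
      ∀ A : Matrix (Fin n) (Fin n) ℝ, A.PosSemidef →
      ∀ τ : Fin n → ℝ, (∀ i, ridgeScore (psdSqrt A) (rankParam c ε k) i ≤ τ i) →
      ∀ (Ω : Type*) [MeasurableSpace Ω] (μ : Measure Ω) [IsProbabilityMeasure μ]
        (X₁ X₂ : Fin (sampleCount c' ε (scaledScore ε k τ)) → Ω → Fin n),
        IsIIDSample μ (sampleProb (scaledScore ε k τ)) X₁ →
        IsIIDSample μ (sampleProb (scaledScore ε k τ)) X₂ →
        1 - 1 / (n : ℝ) ^ d ≤
          μ.real {ω |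
            let S₁ := samplingMatrix (sampleProb (scaledScore ε k τ)) (fun j => X₁ j ω)
            let S₂ := samplingMatrix (sampleProb (scaledScore ε k τ)) (fun j => X₂ j ω)
            IsSpectralPCP ε k (lowRankErrSq A k) (A * S₁) (S₂.transpose * A * S₁)}) ∧
    (∀ c c' K : ℝ, 0 < c → 0 < c' → 1 ≤ K → ∃ C : ℝ, 0 < C ∧
      ∀ (n k : ℕ) (ε : ℝ), 1 ≤ k → 0 < ε → ε < 1 →
      ∀ A : Matrix (Fin n) (Fin n) ℝ, A.PosSemidef →
      ∀ τ : Fin n → ℝ,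
        (∀ i, ridgeScore (psdSqrt A) (rankParam c ε k) i ≤ τ i ∧
          τ i ≤ K * ridgeScore (psdSqrt A) (rankParam c ε k) i) →
        (sampleCount c' ε (scaledScore ε k τ) : ℝ) ≤
          C * (√((n : ℝ) * k) * Real.log n / ε ^ 3)) := by
  refine ⟨fun d hd => ⟨20, 64 * (d + 3), by norm_num, by positivity, ?_⟩, ?_⟩
  · intro c c' hc hc' n k ε hk hε hε1 hn A hA τ hτ Ω _ μ _ X₁ X₂ h₁ h₂
    exact measureReal_isSpectralPCP hd hc hc' hk hε hε1 hn hA hτ rfl rfl μ h₁ h₂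
  · intro c c' K hc hc' hK
    exact ⟨16 * c' * K * (c + 1) + 2, by positivity, fun n k ε hk hε hε1 A hA τ hτ =>
      sampleCount_le hc hc' hK hk hε hε1 hA fun i => (hτ i).2⟩
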